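/- Let $f:(-1,1)\to\mathbb{R}$ be a function with $f(x)(1-x^2)^{1/4}\in L^2(-1,1)$, extended by $0$ to $\mathbb{R}$, and let $$(Hf)(x)=\frac1\pi\,\mathrm{p.v.}\!\int_{-1}^{1}\frac{f(y)}{x-y}\,dy=\lim_{\varepsilon\to0^+}\frac1\pi\int_{\{y\in(-1,1):\,|x-y|>\varepsilon\}}\frac{f(y)}{x-y}\,dy$$ denote its (finite) Hilbert transform. Suppose that $f(x)\sqrt{1-x^2}$ has mean value $0$ with respect to the arcsine distribution $\frac{dx}{\pi\sqrt{1-x^2}}$ on $(-1,1)$, i.e. $$\int_{-1}^{1} f(x)\sqrt{1-x^2}\;\frac{dx}{\pi\sqrt{1-x^2}}=0,$$ or equivalently $\int_{-1}^1 f(x)\,dx=0$. Then the limit defining $(Hf)(x)$ exists for almost every $x\in(-1,1)$, and $$\int_{-1}^{1}(Hf)(x)^2\sqrt{1-x^2}\,dx=\int_{-1}^{1}f(x)^2\sqrt{1-x^2}\,dx,$$ both integrals being finite. -/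

import Mathlib

open MeasureTheory Set Filter Topology

/-- The truncated Hilbert transform `(1/π) ∫_{|x-y|>ε} f(y)/(x-y) dy` of a function on the line. -/
noncomputable def truncatedHilbert (ε : ℝ) (f : ℝ → ℝ) (x : ℝ) : ℝ :=
  (1 / Real.pi) * ∫ y in {y : ℝ | ε < |x - y|}, f y / (x - y)

/-- The Hilbert transform `(Hf)(x) = (1/π) p.v. ∫ f(y)/(x-y) dy` of a function on the line,
the limit of the truncations as `ε → 0+` (an unspecified value where the limit does not exist). -/
noncomputable def hilbertTransform (f : ℝ → ℝ) (x : ℝ) : ℝ :=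
  limUnder (𝓝[>] (0 : ℝ)) (fun ε => truncatedHilbert ε f x)

/-- The extension by zero of a function on `(-1,1)` to the whole line. -/
noncomputable def extendZero (f : ℝ → ℝ) : ℝ → ℝ :=
  (Ioo (-1 : ℝ) 1).indicator f

/-- The finite Hilbert transform: the Hilbert transform of a function on `(-1,1)`, extended by
zero. -/
noncomputable def finiteHilbert (f : ℝ → ℝ) (x : ℝ) : ℝ :=
  hilbertTransform (extendZero f) x

/-- The arcsine distribution `π⁻¹ (1-x²)^{-1/2} dx` on `(-1,1)`. -/
noncomputable def arcsineMeasure : Measure ℝ :=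
  (volume.restrict (Ioo (-1 : ℝ) 1)).withDensity
    (fun x => ENNReal.ofReal (1 / (Real.pi * Real.sqrt (1 - x ^ 2))))

/-!
With `x = cos θ` and `g φ = f (cos φ) |sin φ|`, an even function on the circle, both sides of the
identity become `L²` norms in `θ`: the right-hand side is `∫ g²` over `(0, π)`, and the finite
Hilbert transform satisfies `(Hf)(cos θ) sin θ = -h θ`, where `h` is the conjugate function of `g`,
obtained from the Fourier multiplier `-i sgn n`. The mean value condition says that `g` has no
zeroth Fourier coefficient, so `h` and `g` have the same `L²` norm by Parseval
(`exists_conjugateFunction`); since `h` is odd, this holds on `(0, π)` too.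

The pointwise statement avoids maximal functions. Put `ζ = δ - iθ` with `δ > 0`. Expanding
`sinh ζ / (cosh ζ - cos φ) = ∑ exp (-|n| ζ) exp (i n φ)` shows that `sinh ζ` times the Cauchy
transform `∫ f y / (cosh ζ - y) dy` equals `π` times the Abel mean at `θ` of the Fourier series of
`g + i h` (`tsum_abel_add_conjugate`). By Fatou's theorem it tends to `π (g + i h)` almost
everywhere as `δ → 0` (`exists_conjugate_boundary`), and dividing by `sinh (-iθ) = -i sin θ` one
finds that the real part of the Cauchy transform at `cosh ζ` tends to `-π h θ / sin θ`. On the other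
hand, `cosh ζ` lies within `O(ε²)` of `x - iε` with `ε = sinh δ sin θ`, and the truncated kernel
`1 / s` on `|s| > ε` differs from the real part of `1 / (s - iε)` by an odd kernel bounded by
`ε / (ε² + s²)`. Hence the truncated integrals have the same limit at every Lebesgue point of `f`
(`tendsto_truncatedHilbert_of_boundary`). Both Fatou's theorem and this comparison rest on one
statement about approximate identities, `IsLebesguePoint.tendsto_integral_smul`.
-/

/-! ### Approximate identities at Lebesgue points -/

/-- `x` is a Lebesgue point of `u`: the means of `‖u - u x‖` over shrinking balls around `x` tend
to `0`. The mean over the ball of radius `t` is written with the factor `t⁻¹` instead of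
`(2 t)⁻¹`. -/
def IsLebesguePoint {E : Type*} [NormedAddCommGroup E] (u : ℝ → E) (x : ℝ) : Prop :=
  Tendsto (fun t : ℝ => t⁻¹ * ∫ y in Metric.closedBall x t, ‖u y - u x‖) (𝓝[>] 0) (𝓝 0)

theorem ae_isLebesguePoint {E : Type*} [NormedAddCommGroup E] {u : ℝ → E}
    (hu : LocallyIntegrable u) : ∀ᵐ x, IsLebesguePoint u x := by
  filter_upwards [(Besicovitch.vitaliFamily volume).ae_tendsto_average_norm_sub hu] with x hx
  have h := (hx.comp (Besicovitch.tendsto_filterAt volume x)).const_mul 2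
  rw [mul_zero] at h
  refine h.congr' ?_
  filter_upwards [self_mem_nhdsWithin] with t ht
  have ht : 0 < t := ht
  simp only [Function.comp, setAverage_eq, smul_eq_mul, Measure.real, Real.volume_closedBall]
  rw [ENNReal.toReal_ofReal (by positivity)]
  field_simp

/-- The dyadic majorant of the Cauchy kernel: it reduces integrals against the kernel to means over
balls of radius `2 ^ j * δ`. -/
theorem cauchyKernel_le_tsum {δ : ℝ} (hδ : 0 < δ) (s : ℝ) :
    δ / (δ ^ 2 + s ^ 2) ≤
      ∑' j : ℕ, (4 / δ * (1 / 4) ^ j) * (Metric.closedBall (0 : ℝ) (2 ^ j * δ)).indicator 1 s := by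
  have hle : ∀ (j : ℕ), 0 ≤ (4 / δ * (1 / 4) ^ j) *
      (Metric.closedBall (0 : ℝ) (2 ^ j * δ)).indicator 1 s := fun j =>
    mul_nonneg (by positivity) (indicator_nonneg (fun _ _ => zero_le_one) _)
  have hsum : Summable fun j : ℕ => (4 / δ * (1 / 4) ^ j) *
      (Metric.closedBall (0 : ℝ) (2 ^ j * δ)).indicator 1 s := by
    refine Summable.of_nonneg_of_le hle (fun j => ?_)
      ((summable_geometric_of_lt_one (r := (1 / 4 : ℝ)) (by norm_num) (by norm_num)).mul_left
        (4 / δ))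
    refine mul_le_of_le_one_right (by positivity) ?_
    exact indicator_le_self' (fun _ _ => zero_le_one) _
  have hex : ∃ j : ℕ, |s| ≤ 2 ^ j * δ := by
    obtain ⟨j, hj⟩ := pow_unbounded_of_one_lt (|s| / δ) (by norm_num : (1 : ℝ) < 2)
    exact ⟨j, ((div_lt_iff₀ hδ).1 hj).le⟩
  classical
  set j := Nat.find hex with hj
  have hjs : |s| ≤ 2 ^ j * δ := Nat.find_spec hex
  refine le_trans ?_ (hsum.le_tsum j (fun i _ => hle i))
  rw [indicator_of_mem (by simpa [Metric.mem_closedBall, Real.dist_eq] using hjs), Pi.one_apply,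
    mul_one]
  rcases Nat.eq_zero_or_pos j with h0 | hpos
  · rw [h0, pow_zero, mul_one, div_le_div_iff₀ (by positivity) hδ]
    nlinarith [sq_nonneg s, sq_nonneg δ]
  · obtain ⟨k, hk⟩ : ∃ k, j = k + 1 := ⟨j - 1, by omega⟩
    have hks : 2 ^ k * δ < |s| := by
      have := Nat.find_min hex (m := k) (by omega)
      exact not_le.1 this
    have hsq : (2 ^ k * δ) ^ 2 ≤ s ^ 2 := by
      rw [← sq_abs s]; exact pow_le_pow_left₀ (by positivity) hks.le 2
    have h4 : (4 : ℝ) / δ * (1 / 4) ^ j = δ / (2 ^ k * δ) ^ 2 := by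
      rw [hk, mul_pow, ← pow_mul, mul_comm k 2, pow_mul]
      norm_num
      field_simp
      rw [pow_succ, show (4 : ℝ) * ((1 / 4) ^ k * (1 / 4)) * 4 ^ k = (1 / 4 * 4) ^ k by
        rw [mul_pow]; ring]
      norm_num
    rw [h4]
    exact div_le_div_of_nonneg_left hδ.le (by positivity) (by nlinarith [sq_nonneg δ])

/-- If the means of `v ≥ 0` over balls shrinking to `x` tend to `0`, so do its integrals against
the Cauchy kernel at `x`. By the dyadic majorant these are at most `∑ 4 * 2 ^ (-j) * A (2 ^ j * δ)`,
with `A t = t⁻¹ * ∫ y in closedBall x t, v y`, and dominated convergence applies. -/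
theorem tendsto_integral_cauchyKernel_mul {v : ℝ → ℝ} {x : ℝ} (hv : Integrable v)
    (hv0 : ∀ y, 0 ≤ v y)
    (hx : Tendsto (fun t : ℝ => t⁻¹ * ∫ y in Metric.closedBall x t, v y) (𝓝[>] 0) (𝓝 0)) :
    Tendsto (fun δ : ℝ => ∫ y, δ / (δ ^ 2 + (x - y) ^ 2) * v y) (𝓝[>] 0) (𝓝 0) := by
  set A : ℝ → ℝ := fun t => t⁻¹ * ∫ y in Metric.closedBall x t, v y with hA
  have hI0 : ∀ t, 0 ≤ ∫ y in Metric.closedBall x t, v y := fun t =>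
    integral_nonneg fun y => hv0 y
  have hI1 : ∀ t, ∫ y in Metric.closedBall x t, v y ≤ ∫ y, v y := fun t =>
    setIntegral_le_integral hv (ae_of_all _ hv0)
  have hbdd : ∃ M, ∀ t, 0 < t → A t ≤ M := by
    have h1 : ∀ᶠ t in 𝓝[>] (0 : ℝ), A t < 1 := hx.eventually (gt_mem_nhds one_pos)
    obtain ⟨t₀, ht₀, h⟩ := mem_nhdsGT_iff_exists_Ioo_subset.1 h1
    have ht₀ : 0 < t₀ := ht₀
    -- Small radii are controlled by the limit, large ones by the total integral.
    refine ⟨max 1 (t₀⁻¹ * ∫ y, v y), fun t ht => ?_⟩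
    rcases lt_or_ge t t₀ with htt | htt
    · exact le_max_of_le_left (h ⟨ht, htt⟩ : A t < 1).le
    · refine le_max_of_le_right ?_
      exact mul_le_mul (inv_anti₀ ht₀ htt) (hI1 t) (hI0 t) (by positivity)
  obtain ⟨M, hM⟩ := hbdd
  have hA0 : ∀ t, 0 < t → 0 ≤ A t := fun t ht => mul_nonneg (by positivity) (hI0 t)
  have hlim : Tendsto (fun δ : ℝ => ∑' j : ℕ, 4 * (1 / 2 : ℝ) ^ j * A (2 ^ j * δ)) (𝓝[>] 0)
      (𝓝 0) := by
    have h := tendsto_tsum_of_dominated_convergence (𝓕 := 𝓝[>] (0 : ℝ))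
      (f := fun δ (j : ℕ) => 4 * (1 / 2 : ℝ) ^ j * A (2 ^ j * δ)) (g := fun _ => (0 : ℝ))
      (bound := fun j => 4 * (1 / 2 : ℝ) ^ j * M)
      ((summable_geometric_two.mul_left 4).mul_right M) ?_ ?_
    · simpa using h
    · intro j
      have hj : Tendsto (fun δ : ℝ => 2 ^ j * δ) (𝓝[>] 0) (𝓝[>] 0) := by
        refine tendsto_nhdsWithin_of_tendsto_nhds_of_eventually_within _ ?_ ?_
        · have : Tendsto (fun δ : ℝ => 2 ^ j * δ) (𝓝 0) (𝓝 (2 ^ j * 0)) :=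
            tendsto_id.const_mul _
          rw [mul_zero] at this
          exact this.mono_left nhdsWithin_le_nhds
        · filter_upwards [self_mem_nhdsWithin] with δ hδ
          have hδ : 0 < δ := hδ
          exact mul_pos (pow_pos two_pos j) hδ
      have h := (hx.comp hj).const_mul (4 * (1 / 2 : ℝ) ^ j)
      rw [mul_zero] at h
      exact h
    · filter_upwards [self_mem_nhdsWithin] with δ hδ j
      have hδ : 0 < δ := hδ
      rw [Real.norm_of_nonneg (mul_nonneg (by positivity) (hA0 _ (by positivity)))]
      exact mul_le_mul_of_nonneg_left (hM _ (by positivity)) (by positivity)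
  refine tendsto_of_tendsto_of_tendsto_of_le_of_le' tendsto_const_nhds hlim ?_ ?_
  · filter_upwards [self_mem_nhdsWithin] with δ hδ
    have hδ : 0 < δ := hδ
    exact integral_nonneg fun y => mul_nonneg (by positivity) (hv0 y)
  filter_upwards [self_mem_nhdsWithin] with δ hδ
  have hδ : 0 < δ := hδ
  have hterm : ∀ (j : ℕ) (y : ℝ), (4 / δ * (1 / 4) ^ j) *
      (Metric.closedBall (0 : ℝ) (2 ^ j * δ)).indicator 1 (x - y) * v y =
      (4 / δ * (1 / 4) ^ j) * (Metric.closedBall x (2 ^ j * δ)).indicator v y := by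
    intro j y
    by_cases hy : y ∈ Metric.closedBall x (2 ^ j * δ)
    · have : x - y ∈ Metric.closedBall (0 : ℝ) (2 ^ j * δ) := by
        simpa [Metric.mem_closedBall, Real.dist_eq, abs_sub_comm] using hy
      rw [indicator_of_mem this, indicator_of_mem hy, Pi.one_apply, mul_one]
    · have : x - y ∉ Metric.closedBall (0 : ℝ) (2 ^ j * δ) := by
        simpa [Metric.mem_closedBall, Real.dist_eq, abs_sub_comm] using hy
      rw [indicator_of_notMem this, indicator_of_notMem hy, mul_zero, zero_mul]
  set F : ℕ → ℝ → ℝ := fun j y =>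
    (4 / δ * (1 / 4) ^ j) * (Metric.closedBall x (2 ^ j * δ)).indicator v y with hF
  have hF0 : ∀ j y, 0 ≤ F j y := fun j y =>
    mul_nonneg (by positivity) (indicator_nonneg (fun y _ => hv0 y) y)
  have hFi : ∀ j, Integrable (F j) := fun j =>
    (hv.indicator Metric.isClosed_closedBall.measurableSet).const_mul _
  have hFint : ∀ j, ∫ y, F j y = 4 * (1 / 2 : ℝ) ^ j * A (2 ^ j * δ) := by
    intro j
    rw [hF, integral_const_mul, integral_indicator Metric.isClosed_closedBall.measurableSet]
    simp only [hA]
    have : (1 / 4 : ℝ) ^ j = (1 / 2) ^ j * (2 ^ j)⁻¹ := by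
      rw [← inv_pow, ← mul_pow]; norm_num
    rw [this, mul_inv]
    ring
  have hFsum : Summable fun j => ∫ y, ‖F j y‖ := by
    simp only [Real.norm_of_nonneg (hF0 _ _), hFint]
    refine Summable.of_nonneg_of_le
      (fun j => mul_nonneg (by positivity) (hA0 _ (by positivity))) (fun j => ?_)
      ((summable_geometric_two.mul_left 4).mul_right M)
    exact mul_le_mul_of_nonneg_left (hM _ (by positivity)) (by positivity)
  have hFpt : ∀ y, Summable fun j => F j y := by
    intro y
    refine Summable.of_nonneg_of_le (fun j => hF0 j y) (fun j => ?_)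
      (((summable_geometric_of_lt_one (r := (1 / 4 : ℝ)) (by norm_num) (by norm_num)).mul_left
        (4 / δ)).mul_right (v y))
    exact mul_le_mul_of_nonneg_left (indicator_le_self' (fun _ _ => hv0 y) y) (by positivity)
  have hsi : Integrable fun y => ∑' j, F j y := by
    refine ⟨AEStronglyMeasurable.congr ?_ (ae_of_all _ fun y => rfl), ?_⟩
    · have hm : ∀ n : ℕ, AEStronglyMeasurable (fun y => ∑ j ∈ Finset.range n, F j y) volume :=
        fun n => Finset.aestronglyMeasurable_fun_sum _ fun j _ => (hFi j).1
      exact aestronglyMeasurable_of_tendsto_ae atTop hm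
        (ae_of_all _ fun y => (hFpt y).hasSum.tendsto_sum_nat)
    · have hfin : (∑' j, ∫⁻ y, ‖F j y‖ₑ) < ⊤ := by
        have : ∀ j, ∫⁻ y, ‖F j y‖ₑ = ENNReal.ofReal (∫ y, ‖F j y‖) := fun j =>
          (ofReal_integral_norm_eq_lintegral_enorm (hFi j)).symm
        simp only [this]
        exact hFsum.tsum_ofReal_lt_top
      rw [← lintegral_tsum fun j => (hFi j).1.enorm] at hfin
      refine lt_of_le_of_lt (lintegral_mono fun y => ?_) hfin
      exact enorm_tsum_le_tsum_enorm
  calc ∫ y, δ / (δ ^ 2 + (x - y) ^ 2) * v y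
      ≤ ∫ y, ∑' j, F j y := by
        refine integral_mono_of_nonneg
          (ae_of_all _ fun y => mul_nonneg (by positivity) (hv0 y)) hsi
          (ae_of_all _ fun y => ?_)
        simp only [hF, ← hterm]
        rw [tsum_mul_right]
        exact mul_le_mul_of_nonneg_right (cauchyKernel_le_tsum hδ (x - y)) (hv0 y)
    _ = ∑' j, ∫ y, F j y := (integral_tsum_of_summable_integral_norm hFi hFsum).symm
    _ = ∑' j : ℕ, 4 * (1 / 2 : ℝ) ^ j * A (2 ^ j * δ) := by simp only [hFint]

/-- A family of kernels dominated by the Cauchy kernel, with integrals tending to `m`, converges to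
`m` times the Dirac mass at every Lebesgue point. -/
theorem IsLebesguePoint.tendsto_integral_smul {ι E : Type*} [NormedAddCommGroup E]
    [NormedSpace ℝ E] [CompleteSpace E] {l : Filter ι} {u : ℝ → E} {x R C m : ℝ}
    (hx : IsLebesguePoint u x) (hR : 0 < R) (hu : IntegrableOn u (Metric.closedBall x R))
    {K : ι → ℝ → ℝ} {δ : ι → ℝ} (hδ : Tendsto δ l (𝓝[>] 0))
    (hK : ∀ᶠ i in l, ∀ y ∈ Metric.closedBall x R, |K i y| ≤ C * (δ i / (δ i ^ 2 + (x - y) ^ 2)))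
    (hKm : ∀ᶠ i in l, AEStronglyMeasurable (K i) (volume.restrict (Metric.closedBall x R)))
    (hKint : Tendsto (fun i => ∫ y in Metric.closedBall x R, K i y) l (𝓝 m)) :
    Tendsto (fun i => ∫ y in Metric.closedBall x R, K i y • u y) l (𝓝 (m • u x)) := by
  set B := Metric.closedBall x R with hB
  have hBm : MeasurableSet B := Metric.isClosed_closedBall.measurableSet
  have hconst : IntegrableOn (fun _ : ℝ => u x) B :=
    integrableOn_const (isCompact_closedBall x R).measure_lt_top.ne
  have hsub : IntegrableOn (fun y => u y - u x) B := hu.sub hconst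
  set v : ℝ → ℝ := B.indicator fun y => ‖u y - u x‖ with hv
  have hvi : Integrable v := (integrable_indicator_iff hBm).2 hsub.norm
  have hv0 : ∀ y, 0 ≤ v y := fun y => indicator_nonneg (fun _ _ => norm_nonneg _) y
  have hvx : Tendsto (fun t : ℝ => t⁻¹ * ∫ y in Metric.closedBall x t, v y) (𝓝[>] 0) (𝓝 0) := by
    refine Tendsto.congr' ?_ hx
    filter_upwards [Ioo_mem_nhdsGT hR] with t ht
    congr 1
    refine setIntegral_congr_fun Metric.isClosed_closedBall.measurableSet fun y hy => ?_
    exact (indicator_of_mem (Metric.closedBall_subset_closedBall ht.2.le hy)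
      fun y => ‖u y - u x‖).symm
  have hmain := ((tendsto_integral_cauchyKernel_mul hvi hv0 hvx).comp hδ).const_mul C
  rw [mul_zero] at hmain
  have hδ0 : ∀ᶠ i in l, 0 < δ i := hδ.eventually self_mem_nhdsWithin
  have hKi : ∀ᶠ i in l, ∃ c, ∀ᵐ y ∂(volume.restrict B), ‖K i y‖ ≤ c := by
    filter_upwards [hK, hδ0] with i hi hi0
    refine ⟨|C| * (1 / δ i), (ae_restrict_iff' hBm).2 (ae_of_all _ fun y hy => ?_)⟩
    refine (hi y hy).trans ((mul_le_mul_of_nonneg_right (le_abs_self C) (by positivity)).trans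
      (mul_le_mul_of_nonneg_left ?_ (abs_nonneg C)))
    rw [div_le_div_iff₀ (by positivity) hi0]
    nlinarith [sq_nonneg (x - y)]
  have hdiff : Tendsto (fun i => ∫ y in B, K i y • (u y - u x)) l (𝓝 0) := by
    refine squeeze_zero_norm' ?_ hmain
    filter_upwards [hK, hδ0] with i hi hi0
    refine (norm_integral_le_integral_norm _).trans ?_
    rw [Function.comp, ← integral_const_mul, ← integral_indicator hBm]
    have hbd : ∀ y, ‖C * (δ i / (δ i ^ 2 + (x - y) ^ 2))‖ ≤ |C| * (1 / δ i) := by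
      intro y
      rw [norm_mul, Real.norm_eq_abs, Real.norm_of_nonneg (by positivity)]
      refine mul_le_mul_of_nonneg_left ?_ (abs_nonneg C)
      rw [div_le_div_iff₀ (by positivity) hi0]
      nlinarith [sq_nonneg (x - y)]
    refine integral_mono_of_nonneg
      (ae_of_all _ fun y => indicator_nonneg (fun _ _ => norm_nonneg _) y) ?_
      (ae_of_all _ fun y => ?_)
    · simp only [← mul_assoc]
      refine hvi.bdd_mul (c := |C| * (1 / δ i)) ?_ (ae_of_all _ hbd)
      exact (by fun_prop (disch := intros; positivity) :
        Measurable fun y => C * (δ i / (δ i ^ 2 + (x - y) ^ 2))).aestronglyMeasurable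
    · by_cases hy : y ∈ B
      · simp only [hv, indicator_of_mem hy, norm_smul, ← mul_assoc]
        exact mul_le_mul_of_nonneg_right (hi y hy) (norm_nonneg _)
      · simp [hv, indicator_of_notMem hy]
  have hsum := hdiff.add (hKint.smul_const (u x))
  rw [zero_add] at hsum
  refine hsum.congr' ?_
  filter_upwards [hKi, hKm] with i hi him
  obtain ⟨c, hc⟩ := hi
  have h := integral_add (hsub.bdd_smul c him hc) (hconst.bdd_smul c him hc)
  simp only [Pi.smul_apply', smul_sub, sub_add_cancel] at h
  rw [← integral_smul_const, h]
  simp only [smul_sub]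

/-! ### Abel means of Fourier series -/

/-- The positivity of the period `2π`, needed by the theory of Fourier series. -/
instance factTwoPiPos : Fact (0 < 2 * Real.pi) := ⟨Real.two_pi_pos⟩

/-- The Poisson kernel `sinh ζ / (cosh ζ - cos t)` as a Fourier series. For real `ζ` this is the
usual Poisson kernel of radius `exp (-ζ)`; for `ζ = δ - iθ` it is, up to the factor `sinh ζ`,
the Cauchy kernel at the point `cosh ζ`. -/
theorem hasSum_poissonSeries {ζ : ℂ} (hζ : 0 < ζ.re) (t : ℝ) :
    HasSum (fun n : ℤ => Complex.exp (-(n.natAbs : ℂ) * ζ) * Complex.exp (n * t * Complex.I))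
      (Complex.sinh ζ / (Complex.cosh ζ - Complex.cos t)) := by
  set w := Complex.exp (-ζ) with hw
  set p := Complex.exp (t * Complex.I) with hp
  set q := Complex.exp (-(t * Complex.I)) with hq
  have hpq : p * q = 1 := by rw [hp, hq, ← Complex.exp_add]; simp
  have hp1 : ‖p‖ = 1 := Complex.norm_exp_ofReal_mul_I t
  have hq1 : ‖q‖ = 1 := by
    rw [hq, ← neg_mul, ← Complex.ofReal_neg]; exact Complex.norm_exp_ofReal_mul_I _
  have hw1 : ‖w‖ < 1 := by
    rw [hw, Complex.norm_exp]; simpa using hζ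
  have hwp : ‖w * p‖ < 1 := by rwa [norm_mul, hp1, mul_one]
  have hwq : ‖w * q‖ < 1 := by rwa [norm_mul, hq1, mul_one]
  have h1 : 1 - w * p ≠ 0 := fun h => by
    rw [← sub_eq_zero.1 h, norm_one] at hwp; exact lt_irrefl _ hwp
  have h2 : 1 - w * q ≠ 0 := fun h => by
    rw [← sub_eq_zero.1 h, norm_one] at hwq; exact lt_irrefl _ hwq
  have hw0 : w ≠ 0 := Complex.exp_ne_zero _
  have hval : Complex.sinh ζ / (Complex.cosh ζ - Complex.cos t) =
      (1 - w * p)⁻¹ + (1 - w * q)⁻¹ * (w * q) := by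
    have he : Complex.exp ζ = w⁻¹ := by rw [hw, Complex.exp_neg, inv_inv]
    have hc : Complex.cosh ζ - Complex.cos t = (1 - w * p) * (1 - w * q) / (2 * w) := by
      rw [Complex.cosh, Complex.cos, he, ← hw, neg_mul, ← hp, ← hq]
      field_simp
      linear_combination w ^ 2 * (-hpq)
    have hs : Complex.sinh ζ = (1 - w ^ 2) / (2 * w) := by
      rw [Complex.sinh, he, ← hw]; field_simp
    rw [hc, hs]
    field_simp
    linear_combination w ^ 2 * hpq
  rw [hval]
  refine HasSum.of_nat_of_neg_add_one ?_ ?_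
  · refine (hasSum_geometric_of_norm_lt_one hwp).congr_fun ?_
    intro n
    rw [mul_pow, hw, hp, ← Complex.exp_nat_mul, ← Complex.exp_nat_mul]
    simp [mul_assoc]
  · refine ((hasSum_geometric_of_norm_lt_one hwq).mul_right (w * q)).congr_fun ?_
    intro n
    have : (-((n : ℤ) + 1)).natAbs = n + 1 := by omega
    rw [← pow_succ, mul_pow, hw, hq, ← Complex.exp_nat_mul, ← Complex.exp_nat_mul, this]
    congr 2 <;> push_cast <;> ring

theorem integrableOn_coe_addCircle {u : AddCircle (2 * Real.pi) → ℂ} (hu : Integrable u) (a : ℝ) :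
    IntegrableOn (fun φ : ℝ => u φ) (Ioc a (a + 2 * Real.pi)) :=
  ((AddCircle.measurePreserving_mk (2 * Real.pi) a).integrable_comp hu.1).2 hu

/-- Twisted Abel means of a Fourier series as integrals against the Poisson kernel. -/
theorem hasSum_abel_fourierCoeff {u : AddCircle (2 * Real.pi) → ℂ} (hu : Integrable u) {ζ : ℂ}
    (hζ : 0 < ζ.re) (θ a : ℝ) :
    HasSum (fun n : ℤ => Complex.exp (-(n.natAbs : ℂ) * ζ) * fourierCoeff u n *
        Complex.exp (n * θ * Complex.I))
      ((1 / (2 * Real.pi)) * ∫ φ in Ioc a (a + 2 * Real.pi),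
        Complex.sinh ζ / (Complex.cosh ζ - Complex.cos ((θ - φ : ℝ) : ℂ)) * u φ) := by
  have hui := integrableOn_coe_addCircle hu a
  set F : ℤ → ℝ → ℂ := fun n φ => Complex.exp (-(n.natAbs : ℂ) * ζ) *
    Complex.exp (n * (θ - φ : ℝ) * Complex.I) * u φ with hF
  have hnorm : ∀ (n : ℤ) (φ : ℝ), ‖Complex.exp (n * (θ - φ : ℝ) * Complex.I)‖ = 1 := by
    intro n φ
    have : (n * (θ - φ : ℝ) * Complex.I : ℂ) = ((n * (θ - φ) : ℝ) : ℂ) * Complex.I := by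
      push_cast; ring
    rw [this, Complex.norm_exp_ofReal_mul_I]
  have hFn : ∀ n φ, ‖F n φ‖ = ‖Complex.exp (-(n.natAbs : ℂ) * ζ)‖ * ‖u φ‖ := by
    intro n φ
    simp only [hF]
    rw [norm_mul, norm_mul, hnorm, mul_one]
  have hFi : ∀ n, Integrable (F n) (volume.restrict (Ioc a (a + 2 * Real.pi))) := by
    intro n
    refine hui.bdd_mul (c := ‖Complex.exp (-(n.natAbs : ℂ) * ζ)‖)
      (Continuous.aestronglyMeasurable (by fun_prop)) (ae_of_all _ fun φ => ?_)
    rw [norm_mul, hnorm, mul_one]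
  have hsummable : Summable fun n : ℤ => ‖Complex.exp (-(n.natAbs : ℂ) * ζ)‖ := by
    have := (hasSum_poissonSeries hζ 0).summable.norm
    simpa using this
  have hFs : Summable fun n => ∫ φ in Ioc a (a + 2 * Real.pi), ‖F n φ‖ := by
    simp only [hFn, integral_const_mul]
    exact hsummable.mul_right _
  have h := (hasSum_integral_of_summable_integral_norm hFi hFs).mul_left (1 / (2 * Real.pi) : ℂ)
  have hpt : ∀ φ, ∑' n, F n φ =
      Complex.sinh ζ / (Complex.cosh ζ - Complex.cos ((θ - φ : ℝ) : ℂ)) * u φ := fun φ =>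
    ((hasSum_poissonSeries hζ (θ - φ)).mul_right (u φ)).tsum_eq
  simp only [hpt] at h
  refine h.congr_fun fun n => ?_
  rw [fourierCoeff_eq_intervalIntegral u n a,
    intervalIntegral.integral_of_le (by linarith [Real.two_pi_pos])]
  have : ∀ φ : ℝ, F n φ = Complex.exp (-(n.natAbs : ℂ) * ζ) * Complex.exp (n * θ * Complex.I) *
      (fourier (-n) (φ : AddCircle (2 * Real.pi)) • u φ) := by
    intro φ
    have hπ : (Real.pi : ℂ) ≠ 0 := by exact_mod_cast Real.pi_ne_zero
    rw [fourier_coe_apply, smul_eq_mul, ← mul_assoc, mul_assoc (Complex.exp _) (Complex.exp _),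
      ← Complex.exp_add]
    simp only [hF]
    congr 3
    push_cast
    field_simp
    ring
  simp only [this, integral_const_mul]
  rw [Complex.real_smul]
  push_cast
  ring

/-- The real Poisson kernel has mean value `1`. -/
theorem integral_poissonKernel {δ : ℝ} (hδ : 0 < δ) (θ : ℝ) :
    ∫ φ in Ioc (θ - Real.pi) (θ - Real.pi + 2 * Real.pi),
      Real.sinh δ / (Real.cosh δ - Real.cos (θ - φ)) = 2 * Real.pi := by
  have hu : Integrable (fun _ : AddCircle (2 * Real.pi) => (1 : ℂ)) := integrable_const _
  have h := hasSum_abel_fourierCoeff hu (ζ := δ) (by simpa using hδ) θ (θ - Real.pi)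
  have hc : ∀ n, fourierCoeff (fun _ : AddCircle (2 * Real.pi) => (1 : ℂ)) n =
      if n = 0 then 1 else 0 := by
    intro n
    have := fourierCoeff_fourier (T := 2 * Real.pi) 0
    have h2 : (fun _ : AddCircle (2 * Real.pi) => (1 : ℂ)) = fourier 0 := by
      ext; simp
    rw [h2, this]
    simp [Pi.single_apply]
  have h1 : HasSum (fun n : ℤ => Complex.exp (-(n.natAbs : ℂ) * δ) *
      fourierCoeff (fun _ : AddCircle (2 * Real.pi) => (1 : ℂ)) n *
        Complex.exp (n * θ * Complex.I)) 1 := by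
    have := hasSum_single (f := fun n : ℤ => Complex.exp (-(n.natAbs : ℂ) * δ) *
      fourierCoeff (fun _ : AddCircle (2 * Real.pi) => (1 : ℂ)) n *
        Complex.exp (n * θ * Complex.I)) 0 (fun n hn => by simp [hc, hn])
    simpa [hc] using this
  have h3 := h.unique h1
  have hπ : (Real.pi : ℂ) ≠ 0 := by exact_mod_cast Real.pi_ne_zero
  have h4 : (∫ φ in Ioc (θ - Real.pi) (θ - Real.pi + 2 * Real.pi),
      Complex.sinh δ / (Complex.cosh δ - Complex.cos ((θ - φ : ℝ) : ℂ)) * 1) =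
      ((∫ φ in Ioc (θ - Real.pi) (θ - Real.pi + 2 * Real.pi),
        Real.sinh δ / (Real.cosh δ - Real.cos (θ - φ)) : ℝ) : ℂ) := by
    rw [← integral_complex_ofReal]
    simp
  rw [h4] at h3
  have h5 : ((∫ φ in Ioc (θ - Real.pi) (θ - Real.pi + 2 * Real.pi),
        Real.sinh δ / (Real.cosh δ - Real.cos (θ - φ)) : ℝ) : ℂ) = ((2 * Real.pi : ℝ) : ℂ) := by
    rw [one_div, inv_mul_eq_iff_eq_mul₀ (mul_ne_zero two_ne_zero hπ), mul_one] at h3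
    rw [h3]; push_cast; rfl
  exact_mod_cast h5

theorem tendsto_sinh_nhdsGT : Tendsto Real.sinh (𝓝[>] 0) (𝓝[>] 0) := by
  refine tendsto_nhdsWithin_of_tendsto_nhds_of_eventually_within _ ?_ ?_
  · have := Real.continuous_sinh.tendsto 0
    rw [Real.sinh_zero] at this
    exact this.mono_left nhdsWithin_le_nhds
  · filter_upwards [self_mem_nhdsWithin] with δ hδ
    exact Real.sinh_pos_iff.2 hδ

/-- Fatou's theorem for the radial limits of a Poisson integral: the Abel means of the Fourier
series of an integrable function converge to it almost everywhere. -/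
theorem ae_tendsto_abel_fourierCoeff {u : AddCircle (2 * Real.pi) → ℂ} (hu : Integrable u) :
    ∀ᵐ θ : ℝ, Tendsto (fun δ : ℝ => ∑' n : ℤ, Complex.exp (-(n.natAbs : ℂ) * δ) *
      fourierCoeff u n * Complex.exp (n * θ * Complex.I)) (𝓝[>] 0) (𝓝 (u θ)) := by
  have hper : ∀ a b : ℝ, IntervalIntegrable (fun φ : ℝ => u φ) volume a b := by
    have hP : Function.Periodic (fun φ : ℝ => u φ) (2 * Real.pi) := fun φ => by
      simp
    refine fun a b => hP.intervalIntegrable (t := 0) Real.two_pi_pos.ne' ?_ a b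
    exact (intervalIntegrable_iff_integrableOn_Ioc_of_le (by linarith [Real.two_pi_pos])).2
      (integrableOn_coe_addCircle hu 0)
  have hloc : LocallyIntegrable (fun φ : ℝ => u φ) := by
    rw [MeasureTheory.locallyIntegrable_iff]
    intro k hk
    obtain ⟨r, hr, hkr⟩ := hk.isBounded.subset_closedBall_lt 0 0
    refine IntegrableOn.mono_set ?_ hkr
    rw [Real.closedBall_eq_Icc, integrableOn_Icc_iff_integrableOn_Ioc]
    exact (intervalIntegrable_iff_integrableOn_Ioc_of_le (by linarith)).1 (hper _ _)
  have hball : ∀ θ : ℝ, Metric.closedBall θ Real.pi =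
      Icc (θ - Real.pi) (θ - Real.pi + 2 * Real.pi) := by
    intro θ
    rw [Real.closedBall_eq_Icc]
    congr 1
    ring
  have hcosh : ∀ᶠ δ in 𝓝[>] (0 : ℝ), Real.cosh δ < 3 := by
    have : Tendsto Real.cosh (𝓝[>] 0) (𝓝 1) := by
      have := Real.continuous_cosh.tendsto 0
      rw [Real.cosh_zero] at this
      exact this.mono_left nhdsWithin_le_nhds
    exact this.eventually (gt_mem_nhds (by norm_num))
  filter_upwards [ae_isLebesguePoint hloc] with θ hθ
  have hcos : ∀ δ : ℝ, 0 < δ → ∀ s, 0 < Real.cosh δ - Real.cos s := fun δ hδ s => by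
    linarith [Real.one_lt_cosh.2 hδ.ne', Real.cos_le_one s]
  have key := hθ.tendsto_integral_smul (R := Real.pi) (C := Real.pi ^ 2) (m := 2 * Real.pi)
    (l := 𝓝[>] 0) (δ := Real.sinh)
    (K := fun δ φ => Real.sinh δ / (Real.cosh δ - Real.cos (θ - φ))) Real.pi_pos
    (hloc.integrableOn_isCompact (isCompact_closedBall _ _)) tendsto_sinh_nhdsGT ?_ ?_ ?_
  · have h2 := key.const_mul (1 / (2 * Real.pi) : ℂ)
    have hπ : (Real.pi : ℂ) ≠ 0 := by exact_mod_cast Real.pi_ne_zero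
    have h3 : (1 / (2 * Real.pi) : ℂ) * ((2 * Real.pi : ℝ) • u θ) = u θ := by
      rw [Complex.real_smul]; push_cast; field_simp
    rw [h3] at h2
    refine h2.congr' ?_
    filter_upwards [self_mem_nhdsWithin] with δ hδ
    rw [(hasSum_abel_fourierCoeff hu (ζ := δ) (by simpa using hδ) θ (θ - Real.pi)).tsum_eq,
      hball, integral_Icc_eq_integral_Ioc]
    simp
  · filter_upwards [self_mem_nhdsWithin, hcosh] with δ hδ hδ3 φ hφ
    have hδ : 0 < δ := hδ
    have hs := Real.sinh_pos_iff.2 hδ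
    have hφ : |θ - φ| ≤ Real.pi := by
      rw [abs_sub_comm]; simpa [Metric.mem_closedBall, Real.dist_eq] using hφ
    have hc := Real.cos_le_one_sub_mul_cos_sq hφ
    -- The Cauchy kernel is taken at height `sinh δ`, as `sinh² = (cosh - 1) (cosh + 1)`.
    have hcs : Real.sinh δ ^ 2 / 4 ≤ Real.cosh δ - 1 := by
      nlinarith [Real.cosh_sq δ, Real.one_lt_cosh.2 hδ.ne']
    have hπ : 9 < Real.pi ^ 2 := by nlinarith [Real.pi_gt_three]
    rw [abs_of_nonneg (div_nonneg hs.le (hcos δ hδ _).le), ← mul_div_assoc,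
      div_le_div_iff₀ (hcos δ hδ _) (by positivity)]
    have : Real.sinh δ ^ 2 + (θ - φ) ^ 2 ≤
        Real.pi ^ 2 * (Real.cosh δ - Real.cos (θ - φ)) := by
      have h1 : Real.pi ^ 2 * (2 / Real.pi ^ 2 * (θ - φ) ^ 2) = 2 * (θ - φ) ^ 2 := by
        field_simp
      nlinarith [sq_nonneg (θ - φ), sq_nonneg (Real.sinh δ)]
    nlinarith
  · filter_upwards [self_mem_nhdsWithin] with δ hδ
    refine Continuous.aestronglyMeasurable ?_
    exact continuous_const.div (by fun_prop) fun φ => (hcos δ hδ _).ne'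
  · refine tendsto_const_nhds.congr' ?_
    filter_upwards [self_mem_nhdsWithin] with δ hδ
    rw [hball, integral_Icc_eq_integral_Ioc, integral_poissonKernel hδ]

/-! ### The conjugate function on the circle -/

/-- The conjugation multiplier `-i sgn n` acts on `L²` of the circle, isometrically on functions
with mean value zero. -/
theorem exists_conjugateFunction {g : AddCircle (2 * Real.pi) → ℂ} (hg : MemLp g 2)
    (h0 : fourierCoeff g 0 = 0) :
    ∃ h : AddCircle (2 * Real.pi) → ℂ, MemLp h 2 ∧
      (∀ n : ℤ, fourierCoeff h n = -Complex.I * (n.sign : ℂ) * fourierCoeff g n) ∧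
      ∫ t, ‖h t‖ ^ 2 = ∫ t, ‖g t‖ ^ 2 := by
  have hgh : MemLp g 2 AddCircle.haarAddCircle := memLp_haarAddCircle_iff.2 hg
  set G := hgh.toLp g with hG
  have hGc : ∀ n, fourierCoeff G n = fourierCoeff g n := fun n =>
    congrFun (fourierCoeff_congr_ae hgh.coeFn_toLp) n
  have hb : Memℓp (fun n : ℤ => -Complex.I * (n.sign : ℂ) * fourierBasis.repr G n) 2 := by
    have h2 : (0 : ℝ) < (2 : ENNReal).toReal := by norm_num
    refine (memℓp_gen_iff h2).2 (Summable.of_nonneg_of_le (fun n => by positivity) (fun n => ?_)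
      ((memℓp_gen_iff h2).1 (lp.memℓp (fourierBasis.repr G))))
    refine Real.rpow_le_rpow (norm_nonneg _) ?_ h2.le
    rw [norm_mul]
    refine mul_le_of_le_one_left (norm_nonneg _) ?_
    rcases lt_trichotomy n 0 with hn | rfl | hn
    · simp [Int.sign_eq_neg_one_of_neg hn]
    · simp
    · simp [Int.sign_eq_one_of_pos hn]
  set H := (fourierBasis (T := 2 * Real.pi)).repr.symm (⟨_, hb⟩ : lp (fun _ : ℤ => ℂ) 2) with hH
  have hHc : ∀ n : ℤ, fourierCoeff H n = -Complex.I * (n.sign : ℂ) * fourierCoeff g n := by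
    intro n
    rw [← fourierBasis_repr, hH, LinearIsometryEquiv.apply_symm_apply, ← hGc, ← fourierBasis_repr]
  refine ⟨H, memLp_haarAddCircle_iff.1 (Lp.memLp H), hHc, ?_⟩
  have h1 := tsum_sq_fourierCoeff H
  have h2 := tsum_sq_fourierCoeff G
  have h3 : ∀ n : ℤ, ‖fourierCoeff H n‖ ^ 2 = ‖fourierCoeff G n‖ ^ 2 := by
    intro n
    rw [hHc, hGc]
    rcases lt_trichotomy n 0 with hn | rfl | hn
    · simp [Int.sign_eq_neg_one_of_neg hn]
    · simp [h0]
    · simp [Int.sign_eq_one_of_pos hn]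
  simp only [h3] at h1
  have h4 : ∫ t, ‖G t‖ ^ 2 ∂AddCircle.haarAddCircle =
      ∫ t, ‖g t‖ ^ 2 ∂AddCircle.haarAddCircle := by
    refine integral_congr_ae ?_
    filter_upwards [hgh.coeFn_toLp] with t ht
    rw [ht]
  rw [h2, h4, AddCircle.integral_haarAddCircle, AddCircle.integral_haarAddCircle] at h1
  exact (smul_right_injective ℝ (inv_ne_zero Real.two_pi_pos.ne') h1).symm

theorem fourierCoeff_neg_of_even {g : AddCircle (2 * Real.pi) → ℂ} (hg : ∀ t, g (-t) = g t)
    (n : ℤ) : fourierCoeff g (-n) = fourierCoeff g n := by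
  unfold fourierCoeff
  rw [← integral_neg_eq_self]
  refine integral_congr_ae (ae_of_all _ fun t => ?_)
  simp [hg, fourier_apply]

theorem conj_fourierCoeff_of_real {g : AddCircle (2 * Real.pi) → ℂ}
    (hg : ∀ t, (starRingEnd ℂ) (g t) = g t) (n : ℤ) :
    (starRingEnd ℂ) (fourierCoeff g n) = fourierCoeff g (-n) := by
  unfold fourierCoeff
  rw [← integral_conj]
  refine integral_congr_ae (ae_of_all _ fun t => ?_)
  simp only [smul_eq_mul, map_mul, hg, ← fourier_neg]

theorem sign_neg_cast (n : ℤ) : (((-n).sign : ℤ) : ℂ) = -((n.sign : ℤ) : ℂ) := by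
  rw [Int.sign_neg]; push_cast; ring

theorem summable_abel_fourierCoeff {u : AddCircle (2 * Real.pi) → ℂ} (hu : Integrable u) {δ : ℝ}
    (hδ : 0 < δ) (θ : ℝ) :
    Summable fun n : ℤ => Complex.exp (-(n.natAbs : ℂ) * δ) * fourierCoeff u n *
      Complex.exp (n * θ * Complex.I) :=
  (hasSum_abel_fourierCoeff hu (ζ := δ) (by simpa using hδ) θ 0).summable

/-- For an even function with mean value zero the twisted Abel mean with parameter `δ - iθ` at `0`
is the Abel mean at `θ` of `g + i h`, where `h` is the conjugate function. -/
theorem tsum_abel_add_conjugate {g h : AddCircle (2 * Real.pi) → ℂ} (hg : Integrable g)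
    (hh : Integrable h) (heven : ∀ t, g (-t) = g t) (h0 : fourierCoeff g 0 = 0)
    (hc : ∀ n : ℤ, fourierCoeff h n = -Complex.I * (n.sign : ℂ) * fourierCoeff g n)
    {δ : ℝ} (hδ : 0 < δ) (θ : ℝ) :
    ∑' n : ℤ, Complex.exp (-(n.natAbs : ℂ) * (δ - θ * Complex.I)) * fourierCoeff g n *
        Complex.exp (n * (0 : ℝ) * Complex.I) =
      ∑' n : ℤ, Complex.exp (-(n.natAbs : ℂ) * δ) * fourierCoeff g n *
        Complex.exp (n * θ * Complex.I) +
      Complex.I * ∑' n : ℤ, Complex.exp (-(n.natAbs : ℂ) * δ) * fourierCoeff h n *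
        Complex.exp (n * θ * Complex.I) := by
  have hA := (summable_abel_fourierCoeff hg hδ θ).hasSum.add
    ((summable_abel_fourierCoeff hh hδ θ).hasSum.mul_left Complex.I)
  -- Averaging the terms `n` and `-n` turns `(1 ± sgn n) exp (i n θ)` into `exp (i |n| θ)`.
  have hB := (Equiv.neg ℤ).hasSum_iff.2 hA
  have hC := (hA.add hB).mul_left (1 / 2)
  set S := ∑' n : ℤ, Complex.exp (-(n.natAbs : ℂ) * δ) * fourierCoeff g n *
        Complex.exp (n * θ * Complex.I) +
      Complex.I * ∑' n : ℤ, Complex.exp (-(n.natAbs : ℂ) * δ) * fourierCoeff h n *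
        Complex.exp (n * θ * Complex.I) with hS
  have : (1 / 2 : ℂ) * (S + S) = S := by ring
  rw [this] at hC
  refine (hC.congr_fun fun n => ?_).tsum_eq
  simp only [Function.comp, Equiv.neg_apply, hc, sign_neg_cast, fourierCoeff_neg_of_even heven,
    Int.natAbs_neg]
  rcases lt_trichotomy n 0 with hn | rfl | hn
  · have habs : (n.natAbs : ℂ) = -(n : ℂ) := by
      have : (n.natAbs : ℤ) = -n := by omega
      rw [← Int.cast_natCast, this, Int.cast_neg]
    rw [habs, Int.sign_eq_neg_one_of_neg hn]
    have : Complex.exp (- -(n : ℂ) * (δ - θ * Complex.I)) =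
        Complex.exp (- -(n : ℂ) * δ) * Complex.exp (((-n : ℤ) : ℂ) * θ * Complex.I) := by
      rw [← Complex.exp_add]; congr 1; push_cast; ring
    rw [this]
    simp only [Complex.ofReal_zero, mul_zero, zero_mul, Complex.exp_zero]
    push_cast
    linear_combination (1 / 2 * Complex.exp (- -(n : ℂ) * δ) * fourierCoeff g n *
      (Complex.exp (-n * θ * Complex.I) - Complex.exp (n * θ * Complex.I))) * Complex.I_sq
  · simp [h0]
  · have habs : (n.natAbs : ℂ) = (n : ℂ) := by
      have : (n.natAbs : ℤ) = n := by omega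
      rw [← Int.cast_natCast, this]
    rw [habs, Int.sign_eq_one_of_pos hn]
    have : Complex.exp (-(n : ℂ) * (δ - θ * Complex.I)) =
        Complex.exp (-(n : ℂ) * δ) * Complex.exp ((n : ℂ) * θ * Complex.I) := by
      rw [← Complex.exp_add]; congr 1; ring
    rw [this]
    simp only [Complex.ofReal_zero, mul_zero, zero_mul, Complex.exp_zero]
    push_cast
    linear_combination (1 / 2 * Complex.exp (-(n : ℂ) * δ) * fourierCoeff g n *
      (Complex.exp (n * θ * Complex.I) - Complex.exp (-n * θ * Complex.I))) * Complex.I_sq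

/-- The conjugate function of an even function is odd. -/
theorem ae_conjugate_neg {g h : AddCircle (2 * Real.pi) → ℂ} (hh : Integrable h)
    (heven : ∀ t, g (-t) = g t)
    (hc : ∀ n : ℤ, fourierCoeff h n = -Complex.I * (n.sign : ℂ) * fourierCoeff g n) :
    ∀ᵐ θ : ℝ, h ((-θ : ℝ)) = -h θ := by
  have hF := ae_tendsto_abel_fourierCoeff hh
  filter_upwards [hF, (Measure.measurePreserving_neg volume).quasiMeasurePreserving.ae hF]
    with θ h1 h2
  refine tendsto_nhds_unique h2 (h1.neg.congr fun δ => ?_)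
  rw [← (Equiv.neg ℤ).tsum_eq, ← tsum_neg]
  refine tsum_congr fun n => ?_
  simp only [Equiv.neg_apply, hc, sign_neg_cast, fourierCoeff_neg_of_even heven,
    Int.natAbs_neg]
  push_cast
  rw [neg_mul_neg]
  ring_nf

/-- The conjugate function of a real function is real. -/
theorem ae_conj_conjugate {g h : AddCircle (2 * Real.pi) → ℂ} (hh : Integrable h)
    (hreal : ∀ t, (starRingEnd ℂ) (g t) = g t)
    (hc : ∀ n : ℤ, fourierCoeff h n = -Complex.I * (n.sign : ℂ) * fourierCoeff g n) :
    ∀ᵐ θ : ℝ, (starRingEnd ℂ) (h θ) = h θ := by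
  filter_upwards [ae_tendsto_abel_fourierCoeff hh] with θ h1
  have h2 := (Complex.continuous_conj.tendsto (h θ)).comp h1
  refine tendsto_nhds_unique h2 (h1.congr fun δ => ?_)
  rw [Function.comp, Complex.conj_tsum, ← (Equiv.neg ℤ).tsum_eq]
  refine tsum_congr fun n => ?_
  simp only [Equiv.neg_apply, hc, sign_neg_cast, Int.natAbs_neg, map_mul, map_neg,
    ← Complex.exp_conj, Complex.conj_ofReal, Complex.conj_I, conj_fourierCoeff_of_real hreal,
    map_natCast, map_intCast]
  push_cast
  ring_nf

theorem setIntegral_Ioc_eq_of_ae_even {E : Type*} [NormedAddCommGroup E] [NormedSpace ℝ E]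
    {F : ℝ → E} {a : ℝ} (ha : 0 < a) (hF : IntegrableOn F (Ioc (-a) a))
    (he : ∀ᵐ φ, F (-φ) = F φ) :
    ∫ φ in Ioc (-a) a, F φ = (2 : ℝ) • ∫ φ in Ioo 0 a, F φ := by
  have h1 : IntervalIntegrable F volume (-a) 0 :=
    (intervalIntegrable_iff_integrableOn_Ioc_of_le (by linarith)).2
      (hF.mono_set (Ioc_subset_Ioc_right ha.le))
  have h2 : IntervalIntegrable F volume 0 a :=
    (intervalIntegrable_iff_integrableOn_Ioc_of_le ha.le).2
      (hF.mono_set (Ioc_subset_Ioc_left (by linarith)))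
  rw [← intervalIntegral.integral_of_le (by linarith),
    ← intervalIntegral.integral_add_adjacent_intervals h1 h2, ← integral_Ioc_eq_integral_Ioo,
    ← intervalIntegral.integral_of_le ha.le, two_smul]
  congr 1
  have h3 := intervalIntegral.integral_comp_neg (a := 0) (b := a) F
  rw [neg_zero] at h3
  rw [← h3]
  exact intervalIntegral.integral_congr_ae (he.mono fun φ h _ => h)

/-- The boundary behaviour of the Cauchy transform in angular coordinates: for an even `2π`-periodic
`γ` with mean value zero there is a function `η` on `(0, π)`, its conjugate function, with the same
`L²` norm and such that the transform of `γ` with kernel `sinh ζ / (cosh ζ - cos φ)` tends to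
`π (γ + i η)` as `ζ = δ - iθ` tends to `-iθ`. -/
theorem exists_conjugate_boundary {γ : ℝ → ℝ} (hper : Function.Periodic γ (2 * Real.pi))
    (heven : ∀ φ, γ (-φ) = γ φ) (hγ : MemLp γ 2 (volume.restrict (Ioc (-Real.pi) Real.pi)))
    (hmean : ∫ φ in Ioc (-Real.pi) Real.pi, γ φ = 0) :
    ∃ η : ℝ → ℝ, IntegrableOn (fun θ => η θ ^ 2) (Ioo 0 Real.pi) ∧
      ∫ θ in Ioo 0 Real.pi, η θ ^ 2 = ∫ θ in Ioo 0 Real.pi, γ θ ^ 2 ∧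
      ∀ᵐ θ : ℝ, Tendsto (fun δ : ℝ => ∫ φ in Ioo 0 Real.pi,
        Complex.sinh (δ - θ * Complex.I) /
          (Complex.cosh (δ - θ * Complex.I) - Complex.cos φ) * γ φ)
        (𝓝[>] 0) (𝓝 (Real.pi * (γ θ + η θ * Complex.I))) := by
  have hπ := Real.pi_pos
  have hend : -Real.pi + 2 * Real.pi = Real.pi := by ring
  set g : AddCircle (2 * Real.pi) → ℂ := fun t => ((hper.lift t : ℝ) : ℂ) with hgdef
  have hgcoe : ∀ φ : ℝ, g φ = γ φ := fun φ => by simp only [hgdef, hper.lift_coe]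
  have hgeven : ∀ t, g (-t) = g t := by
    intro t
    induction t using QuotientAddGroup.induction_on with
    | H φ => rw [← AddCircle.coe_neg, hgcoe, hgcoe, heven]
  have hgreal : ∀ t, (starRingEnd ℂ) (g t) = g t := fun t => Complex.conj_ofReal _
  have hgL : MemLp g 2 := by
    have h1 : MemLp (fun φ => (γ φ : ℂ)) 2
        (volume.restrict (Ioc (-Real.pi) (-Real.pi + 2 * Real.pi))) := by
      rw [hend]; exact hγ.ofReal
    have h2 := h1.memLp_liftIoc
    convert h2 using 1
    ext t
    obtain ⟨φ, hφ, rfl⟩ : t ∈ QuotientAddGroup.mk '' Ioc (-Real.pi) (-Real.pi + 2 * Real.pi) := by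
      rw [AddCircle.coe_image_Ioc_eq]; trivial
    exact (hgcoe φ).trans (AddCircle.liftIoc_coe_apply (f := fun φ => (γ φ : ℂ)) hφ).symm
  have hgi : Integrable g := hgL.integrable (by norm_num)
  have hg0 : fourierCoeff g 0 = 0 := by
    rw [fourierCoeff_eq_intervalIntegral g 0 (-Real.pi), hend,
      intervalIntegral.integral_of_le (by linarith)]
    simp [hgcoe, integral_complex_ofReal, hmean]
  obtain ⟨h, hhL, hc, hnorm⟩ := exists_conjugateFunction hgL hg0
  have hhi : Integrable h := hhL.integrable (by norm_num)
  have hhreal := ae_conj_conjugate hhi hgreal hc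
  have hhodd := ae_conjugate_neg hhi hgeven hc
  have hre : ∀ᵐ θ : ℝ, ((h θ).re : ℂ) = h θ := by
    filter_upwards [hhreal] with θ hθ
    exact Complex.conj_eq_iff_re.1 hθ
  have hre2 : ∀ᵐ θ : ℝ, (h θ).re ^ 2 = ‖h θ‖ ^ 2 := by
    filter_upwards [hre] with θ hθ
    rw [← hθ, Complex.norm_real, Complex.ofReal_re, Real.norm_eq_abs, sq_abs]
  have hint : ∀ {u : AddCircle (2 * Real.pi) → ℂ}, MemLp u 2 →
      IntegrableOn (fun θ : ℝ => ‖u θ‖ ^ 2) (Ioc (-Real.pi) Real.pi) := by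
    intro u hu
    have h1 := (memLp_two_iff_integrable_sq_norm hu.1).1 hu
    have h2 := ((AddCircle.measurePreserving_mk (2 * Real.pi) (-Real.pi)).integrable_comp h1.1).2 h1
    rwa [hend] at h2
  have hηi : IntegrableOn (fun θ : ℝ => (h θ).re ^ 2) (Ioc (-Real.pi) Real.pi) :=
    (hint hhL).congr (ae_restrict_of_ae (hre2.mono fun θ hθ => hθ.symm))
  have hsub : Ioo 0 Real.pi ⊆ Ioc (-Real.pi) Real.pi := fun φ hφ => ⟨by linarith [hφ.1], hφ.2.le⟩
  refine ⟨fun θ => (h θ).re, hηi.mono_set hsub, ?_, ?_⟩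
  · have h1 := setIntegral_Ioc_eq_of_ae_even hπ hηi (by
      filter_upwards [hhodd] with θ hθ
      rw [hθ]; simp)
    have hγi : IntegrableOn (fun θ : ℝ => γ θ ^ 2) (Ioc (-Real.pi) Real.pi) := by
      simpa [hgcoe] using hint hgL
    have h2 := setIntegral_Ioc_eq_of_ae_even hπ hγi (ae_of_all _ fun θ => by rw [heven])
    have h3 : ∫ θ in Ioc (-Real.pi) Real.pi, (h θ).re ^ 2 =
        ∫ θ in Ioc (-Real.pi) Real.pi, γ θ ^ 2 := by
      have e1 := AddCircle.integral_preimage (2 * Real.pi) (-Real.pi) (fun t => ‖h t‖ ^ 2)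
      have e2 := AddCircle.integral_preimage (2 * Real.pi) (-Real.pi) (fun t => ‖g t‖ ^ 2)
      rw [hend] at e1 e2
      rw [integral_congr_ae (ae_restrict_of_ae hre2), e1, hnorm, ← e2]
      simp [hgcoe]
    rw [h1, h2] at h3
    simpa using h3
  · filter_upwards [ae_tendsto_abel_fourierCoeff hgi, ae_tendsto_abel_fourierCoeff hhi, hre]
      with θ h1 h2 h3
    have h4 := (h1.add (h2.const_mul Complex.I)).const_mul (Real.pi : ℂ)
    rw [hgcoe, ← h3, mul_comm Complex.I] at h4
    refine h4.congr' ?_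
    filter_upwards [self_mem_nhdsWithin] with δ hδ
    have hδ : 0 < δ := hδ
    have hζ : 0 < (δ - θ * Complex.I : ℂ).re := by simpa using hδ
    rw [← tsum_abel_add_conjugate hgi hhi hgeven hg0 hc hδ θ]
    have h5 := hasSum_abel_fourierCoeff hgi hζ 0 (-Real.pi)
    rw [h5.tsum_eq, hend, setIntegral_Ioc_eq_of_ae_even hπ ?_ ?_]
    · have hπ0 : (Real.pi : ℂ) ≠ 0 := by exact_mod_cast hπ.ne'
      simp only [hgcoe, zero_sub, Complex.ofReal_neg, Complex.cos_neg, Complex.real_smul]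
      push_cast
      field_simp
    · have hgI := integrableOn_coe_addCircle hgi (-Real.pi)
      rw [hend] at hgI
      have hS : Summable fun n : ℤ => ‖Complex.exp (-(n.natAbs : ℂ) * (δ - θ * Complex.I))‖ := by
        simpa using (hasSum_poissonSeries hζ 0).summable.norm
      refine hgI.bdd_mul (c := ∑' n : ℤ, ‖Complex.exp (-(n.natAbs : ℂ) * (δ - θ * Complex.I))‖)
        ?_ (ae_of_all _ fun φ => ?_)
      · exact (by fun_prop : Measurable fun φ : ℝ => Complex.sinh (δ - θ * Complex.I) /
          (Complex.cosh (δ - θ * Complex.I) -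
            Complex.cos ((0 - φ : ℝ) : ℂ))).aestronglyMeasurable
      · rw [← (hasSum_poissonSeries hζ (0 - φ)).tsum_eq]
        have hn : ∀ n : ℤ, ‖Complex.exp (-(n.natAbs : ℂ) * (δ - θ * Complex.I)) *
            Complex.exp (n * (0 - φ : ℝ) * Complex.I)‖ =
            ‖Complex.exp (-(n.natAbs : ℂ) * (δ - θ * Complex.I))‖ := by
          intro n
          have : (n * (0 - φ : ℝ) * Complex.I : ℂ) = ((n * (0 - φ) : ℝ) : ℂ) * Complex.I := by
            push_cast; ring
          rw [norm_mul, this, Complex.norm_exp_ofReal_mul_I, mul_one]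
        simp only [← hn]
        refine norm_tsum_le_tsum_norm ?_
        simpa only [hn] using hS
    · refine ae_of_all _ fun φ => ?_
      rw [hgcoe, hgcoe, heven]
      simp

/-! ### Truncations and the Cauchy transform -/

theorem setIntegral_closedBall_eq_zero_of_odd {φ : ℝ → ℝ} (hφ : ∀ s, φ (-s) = -φ s) (x R : ℝ) :
    ∫ y in Metric.closedBall x R, φ (x - y) = 0 := by
  have h1 : ∫ y in Metric.closedBall x R, φ (x - y) =
      ∫ s in Metric.closedBall (0 : ℝ) R, φ s := by
    rw [← integral_indicator Metric.isClosed_closedBall.measurableSet,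
      ← integral_indicator Metric.isClosed_closedBall.measurableSet,
      ← integral_sub_left_eq_self ((Metric.closedBall (0 : ℝ) R).indicator φ) volume x]
    refine integral_congr_ae (ae_of_all _ fun y => ?_)
    classical
    simp only [indicator_apply, Metric.mem_closedBall, Real.dist_eq, sub_zero, abs_sub_comm]
  have h2 : ∫ s in Metric.closedBall (0 : ℝ) R, φ s =
      -∫ s in Metric.closedBall (0 : ℝ) R, φ s := by
    rw [← integral_neg, ← integral_indicator Metric.isClosed_closedBall.measurableSet,
      ← integral_indicator Metric.isClosed_closedBall.measurableSet, ← integral_neg_eq_self]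
    refine integral_congr_ae (ae_of_all _ fun y => ?_)
    classical
    simp only [indicator_apply, Metric.mem_closedBall, Real.dist_eq, sub_zero, abs_neg, hφ]
  rw [h1]
  linarith

theorem re_inv_sub_mul_I (s ε : ℝ) : ((s - ε * Complex.I : ℂ)⁻¹).re = s / (s ^ 2 + ε ^ 2) := by
  simp [Complex.inv_re, Complex.normSq_apply, sq]

/-- At a Lebesgue point the truncated integral differs from the real part of the Cauchy transform
at height `ε` by a quantity tending to `0`: the difference of the kernels is odd and dominated by
the Cauchy kernel. -/
theorem tendsto_truncated_sub_re_cauchy {u : ℝ → ℝ} {x R : ℝ} (hR : 0 < R) (hu : Integrable u)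
    (hsupp : ∀ y ∉ Metric.closedBall x R, u y = 0) (hx : IsLebesguePoint u x) :
    Tendsto (fun ε : ℝ => (∫ y in {y : ℝ | ε < |x - y|}, u y / (x - y)) -
      ∫ y : ℝ, ((x - ε * Complex.I - y : ℂ)⁻¹).re * u y) (𝓝[>] 0) (𝓝 0) := by
  set κ : ℝ → ℝ → ℝ := fun ε s => {s : ℝ | ε < |s|}.indicator (fun s => s⁻¹) s -
    s / (s ^ 2 + ε ^ 2) with hκ
  have hset : ∀ ε : ℝ, MeasurableSet {s : ℝ | ε < |s|} := fun ε =>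
    measurableSet_lt measurable_const measurable_norm
  have hκm : ∀ ε, Measurable (κ ε) := fun ε =>
    (measurable_inv.indicator (hset ε)).sub (by fun_prop)
  have hκodd : ∀ ε s, κ ε (-s) = -κ ε s := by
    intro ε s
    by_cases h : ε < |s|
    · simp only [hκ, indicator_apply, mem_ofPred_eq, abs_neg, if_pos h]
      rw [inv_neg, neg_sq]; ring
    · simp only [hκ, indicator_apply, mem_ofPred_eq, abs_neg, if_neg h]
      rw [neg_sq]; ring
  have hκle : ∀ ε : ℝ, 0 < ε → ∀ s, |κ ε s| ≤ 1 * (ε / (ε ^ 2 + s ^ 2)) := by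
    intro ε hε s
    by_cases h : ε < |s|
    · have hs : s ≠ 0 := fun h0 => by rw [h0, abs_zero] at h; linarith
      have : κ ε s = ε ^ 2 / (s * (ε ^ 2 + s ^ 2)) := by
        simp only [hκ, indicator_apply, mem_ofPred_eq, if_pos h]
        have : s ^ 2 + ε ^ 2 ≠ 0 := by positivity
        have : ε ^ 2 + s ^ 2 ≠ 0 := by positivity
        field_simp
        ring
      rw [this, abs_div, abs_mul, abs_of_pos (by positivity : 0 < ε ^ 2),
        abs_of_pos (by positivity : 0 < ε ^ 2 + s ^ 2), one_mul, div_mul_eq_div_div]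
      refine div_le_div_of_nonneg_right ?_ (by positivity)
      rw [div_le_iff₀ (abs_pos.2 hs)]
      nlinarith
    · simp only [hκ, indicator_apply, mem_ofPred_eq, if_neg h]
      rw [zero_sub, abs_neg, abs_div, abs_of_pos (by positivity : 0 < s ^ 2 + ε ^ 2), one_mul,
        add_comm]
      exact div_le_div_of_nonneg_right (not_lt.1 h) (by positivity)
  have key := hx.tendsto_integral_smul (l := 𝓝[>] (0 : ℝ)) (C := 1) (m := 0) hR hu.integrableOn
    (K := fun ε y => κ ε (x - y)) (δ := fun ε => ε) tendsto_id
    (by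
      filter_upwards [self_mem_nhdsWithin] with ε hε y _
      exact hκle ε hε _)
    (Eventually.of_forall fun ε =>
      ((hκm ε).comp (measurable_const.sub measurable_id)).aestronglyMeasurable)
    (by simp only [setIntegral_closedBall_eq_zero_of_odd (hκodd _)]; exact tendsto_const_nhds)
  rw [zero_smul] at key
  refine key.congr' ?_
  filter_upwards [self_mem_nhdsWithin] with ε hε
  have hε : 0 < ε := hε
  have hset' : MeasurableSet {y : ℝ | ε < |x - y|} :=
    (hset ε).preimage (measurable_const.sub measurable_id)
  rw [setIntegral_eq_integral_of_forall_compl_eq_zero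
    (fun y hy => by rw [hsupp y hy, smul_zero]), ← integral_indicator hset', ← integral_sub]
  · refine integral_congr_ae (ae_of_all _ fun y => ?_)
    have h1 : (x - ε * Complex.I - y : ℂ) = ((x - y : ℝ) : ℂ) - ε * Complex.I := by
      push_cast; ring
    simp only [h1, re_inv_sub_mul_I]
    by_cases h : ε < |x - y|
    · simp only [hκ, indicator_apply, mem_ofPred_eq, if_pos h, smul_eq_mul]
      ring
    · simp only [hκ, indicator_apply, mem_ofPred_eq, if_neg h, smul_eq_mul]
      ring
  · have : ({y : ℝ | ε < |x - y|}.indicator fun y => u y / (x - y)) =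
        fun y => ({y : ℝ | ε < |x - y|}.indicator (fun y => (x - y)⁻¹) y) * u y := by
      ext y
      by_cases h : ε < |x - y|
      · simp only [indicator_apply, mem_ofPred_eq, if_pos h]; ring
      · simp only [indicator_apply, mem_ofPred_eq, if_neg h]; ring
    rw [this]
    refine hu.bdd_mul (c := ε⁻¹) ((by fun_prop : Measurable fun y : ℝ =>
      (x - y)⁻¹).indicator hset').aestronglyMeasurable (ae_of_all _ fun y => ?_)
    by_cases h : ε < |x - y|
    · simp only [indicator_apply, mem_ofPred_eq, if_pos h, norm_inv, Real.norm_eq_abs]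
      exact inv_anti₀ hε h.le
    · simp only [indicator_apply, mem_ofPred_eq, if_neg h, norm_zero]
      positivity
  · refine hu.bdd_mul (c := ε⁻¹) (Measurable.aestronglyMeasurable (by fun_prop))
      (ae_of_all _ fun y => ?_)
    refine (Complex.abs_re_le_norm _).trans ?_
    rw [norm_inv]
    refine inv_anti₀ hε ?_
    simpa [abs_of_pos hε] using Complex.abs_im_le_norm (x - ε * Complex.I - y : ℂ)

/-- A horizontal displacement of order `ε²` of the point at height `ε` does not affect the limit
of the Cauchy transform. -/
theorem tendsto_re_cauchy_sub_re_cauchy {u : ℝ → ℝ} {x C : ℝ} (hu : Integrable u) {a : ℝ → ℝ}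
    (ha : ∀ ε, |a ε - x| ≤ C * ε ^ 2) :
    Tendsto (fun ε : ℝ => (∫ y : ℝ, ((x - ε * Complex.I - y : ℂ)⁻¹).re * u y) -
      ∫ y : ℝ, ((a ε - ε * Complex.I - y : ℂ)⁻¹).re * u y) (𝓝[>] 0) (𝓝 0) := by
  have him : ∀ (b ε y : ℝ), 0 < ε → ε ≤ ‖(b - ε * Complex.I - y : ℂ)‖ := by
    intro b ε y hε
    simpa [abs_of_pos hε] using Complex.abs_im_le_norm (b - ε * Complex.I - y : ℂ)
  have hint : ∀ (b ε : ℝ), 0 < ε →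
      Integrable fun y : ℝ => ((b - ε * Complex.I - y : ℂ)⁻¹).re * u y := by
    intro b ε hε
    refine hu.bdd_mul (c := ε⁻¹) (Measurable.aestronglyMeasurable (by fun_prop))
      (ae_of_all _ fun y => ?_)
    refine (Complex.abs_re_le_norm _).trans ?_
    rw [norm_inv]
    exact inv_anti₀ hε (him b ε y hε)
  have hdct : Tendsto (fun ε : ℝ => ∫ y : ℝ, (((x - ε * Complex.I - y : ℂ)⁻¹).re -
      ((a ε - ε * Complex.I - y : ℂ)⁻¹).re) * u y) (𝓝[>] 0) (𝓝 (∫ _ : ℝ, (0 : ℝ))) := by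
    refine tendsto_integral_filter_of_dominated_convergence (fun y => C * |u y|) ?_ ?_
      (hu.abs.const_mul C) ?_
    · refine Eventually.of_forall fun ε => ?_
      exact (Measurable.aestronglyMeasurable (by fun_prop)).mul hu.1
    -- Both denominators have modulus at least `ε`, so the displacement `C * ε ^ 2` is absorbed.
    · filter_upwards [self_mem_nhdsWithin] with ε hε
      have hε : 0 < ε := hε
      refine ae_of_all _ fun y => ?_
      rw [norm_mul, Real.norm_eq_abs, Real.norm_eq_abs]
      refine mul_le_mul_of_nonneg_right ?_ (abs_nonneg _)
      have h1 := him x ε y hε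
      have h2 := him (a ε) ε y hε
      have n1 : (x - ε * Complex.I - y : ℂ) ≠ 0 := norm_pos_iff.1 (hε.trans_le h1)
      have n2 : (a ε - ε * Complex.I - y : ℂ) ≠ 0 := norm_pos_iff.1 (hε.trans_le h2)
      rw [← Complex.sub_re]
      refine (Complex.abs_re_le_norm _).trans ?_
      rw [inv_sub_inv n1 n2, norm_div, norm_mul]
      have h3 : ‖((a ε - ε * Complex.I - y) - (x - ε * Complex.I - y) : ℂ)‖ = |a ε - x| := by
        rw [← Real.norm_eq_abs, ← Complex.norm_real]; congr 1; push_cast; ring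
      rw [h3, div_le_iff₀ (by positivity)]
      have hC : 0 ≤ C := by
        have := (abs_nonneg _).trans (ha ε)
        exact nonneg_of_mul_nonneg_left this (by positivity)
      refine (ha ε).trans (mul_le_mul_of_nonneg_left ?_ hC)
      rw [sq]
      exact mul_le_mul h1 h2 hε.le (norm_nonneg _)
    · have hne : ∀ᵐ y : ℝ, y ≠ x := by simp [ae_iff, measure_singleton]
      filter_upwards [hne] with y hy
      have hid : Tendsto (fun ε : ℝ => ε) (𝓝[>] 0) (𝓝 0) := nhdsWithin_le_nhds
      have ha0 : Tendsto a (𝓝[>] 0) (𝓝 x) := by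
        rw [tendsto_iff_norm_sub_tendsto_zero]
        refine squeeze_zero (fun _ => norm_nonneg _) ha ?_
        simpa using (hid.pow 2).const_mul C
      have hxy : (x - (0 : ℝ) * Complex.I - y : ℂ) ≠ 0 := by
        simpa [sub_eq_zero] using fun h : (x : ℂ) = y => hy (by exact_mod_cast h.symm)
      have hgen : ∀ b : ℝ → ℝ, Tendsto b (𝓝[>] 0) (𝓝 x) →
          Tendsto (fun ε : ℝ => ((b ε - ε * Complex.I - y : ℂ)⁻¹).re) (𝓝[>] 0)
            (𝓝 ((x - (0 : ℝ) * Complex.I - y : ℂ)⁻¹).re) := by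
        intro b hb
        refine (Complex.continuous_re.tendsto _).comp (Tendsto.inv₀ ?_ hxy)
        have h1 := (Complex.continuous_ofReal.tendsto x).comp hb
        have h2 := (Complex.continuous_ofReal.tendsto 0).comp hid
        exact (h1.sub (h2.mul_const _)).sub_const _
      have := ((hgen _ tendsto_const_nhds).sub (hgen a ha0)).mul_const (u y)
      simpa using this
  rw [integral_zero] at hdct
  refine hdct.congr' ?_
  filter_upwards [self_mem_nhdsWithin] with ε hε
  rw [← integral_sub (hint x ε hε) (hint (a ε) ε hε)]
  simp only [sub_mul]

/-! ### The substitution `x = cos θ` -/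

theorem image_cos_Ioo : Real.cos '' Ioo 0 Real.pi = Ioo (-1 : ℝ) 1 := by
  ext x
  constructor
  · rintro ⟨θ, hθ, rfl⟩
    have h := Real.sin_pos_of_mem_Ioo hθ
    constructor <;> nlinarith [Real.sin_sq_add_cos_sq θ]
  · intro hx
    exact ⟨Real.arccos x, ⟨Real.arccos_pos.2 hx.2, Real.arccos_lt_pi.2 hx.1⟩,
      Real.cos_arccos hx.1.le hx.2.le⟩

theorem setIntegral_cos_substitution {E : Type*} [NormedAddCommGroup E] [NormedSpace ℝ E]
    (F : ℝ → E) :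
    ∫ x in Ioo (-1 : ℝ) 1, F x = ∫ θ in Ioo 0 Real.pi, Real.sin θ • F (Real.cos θ) := by
  rw [← image_cos_Ioo, integral_image_eq_integral_abs_deriv_smul measurableSet_Ioo
    (fun θ _ => (Real.hasDerivAt_cos θ).hasDerivWithinAt)
    (Real.injOn_cos.mono Ioo_subset_Icc_self)]
  refine setIntegral_congr_fun measurableSet_Ioo fun θ hθ => ?_
  simp only [abs_neg, abs_of_pos (Real.sin_pos_of_mem_Ioo hθ)]

theorem integrableOn_cos_substitution {E : Type*} [NormedAddCommGroup E] [NormedSpace ℝ E]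
    (F : ℝ → E) :
    IntegrableOn F (Ioo (-1 : ℝ) 1) ↔
      IntegrableOn (fun θ => Real.sin θ • F (Real.cos θ)) (Ioo 0 Real.pi) := by
  rw [← image_cos_Ioo, integrableOn_image_iff_integrableOn_abs_deriv_smul measurableSet_Ioo
    (fun θ _ => (Real.hasDerivAt_cos θ).hasDerivWithinAt)
    (Real.injOn_cos.mono Ioo_subset_Icc_self)]
  refine integrableOn_congr_fun (fun θ hθ => ?_) measurableSet_Ioo
  simp only [abs_neg, abs_of_pos (Real.sin_pos_of_mem_Ioo hθ)]

theorem ae_arccos {P : ℝ → Prop} (hP : ∀ᵐ θ, P θ) :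
    ∀ᵐ x, x ∈ Ioo (-1 : ℝ) 1 → P (Real.arccos x) := by
  rw [ae_iff] at hP ⊢
  have h := addHaar_image_eq_zero_of_differentiableOn_of_addHaar_eq_zero volume
    Real.differentiable_cos.differentiableOn hP
  refine measure_mono_null (fun x hx => ?_) h
  simp only [mem_ofPred_eq, Classical.not_imp] at hx
  exact ⟨Real.arccos x, hx.2, Real.cos_arccos hx.1.1.le hx.1.2.le⟩

theorem sqrt_one_sub_cos_sq {θ : ℝ} (hθ : θ ∈ Ioo 0 Real.pi) :
    √(1 - Real.cos θ ^ 2) = Real.sin θ := by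
  rw [← Real.sin_sq, Real.sqrt_sq (Real.sin_pos_of_mem_Ioo hθ).le]

theorem integrableOn_Ioc_of_even {F : ℝ → ℝ} {a : ℝ} (ha : 0 < a) (hF : IntegrableOn F (Ioo 0 a))
    (he : ∀ φ, F (-φ) = F φ) : IntegrableOn F (Ioc (-a) a) := by
  have h1 : IntervalIntegrable F volume 0 a :=
    (intervalIntegrable_iff_integrableOn_Ioo_of_le ha.le).2 hF
  have h2 : IntervalIntegrable F volume 0 (-a) := by
    have := (IntervalIntegrable.iff_comp_neg (f := F) (a := 0) (b := a)).1 h1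
    simpa [he] using this
  exact (intervalIntegrable_iff_integrableOn_Ioc_of_le (by linarith)).1 (h2.symm.trans h1)

theorem integrableOn_arcsine_density :
    IntegrableOn (fun x : ℝ => (√(1 - x ^ 2))⁻¹) (Ioo (-1 : ℝ) 1) := by
  rw [integrableOn_cos_substitution]
  refine (integrableOn_congr_fun (g := fun _ => (1 : ℝ)) (fun θ hθ => ?_) measurableSet_Ioo).2
    (integrableOn_const (by simp))
  have := Real.sin_pos_of_mem_Ioo hθ
  simp only [sqrt_one_sub_cos_sq hθ, smul_eq_mul]
  exact mul_inv_cancel₀ this.ne'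

theorem rpow_quarter_sq {t : ℝ} (ht : 0 ≤ t) : (t ^ (1 / 4 : ℝ)) ^ 2 = √t := by
  rw [← Real.rpow_natCast, ← Real.rpow_mul ht, Real.sqrt_eq_rpow]
  norm_num

theorem one_sub_sq_pos_of_mem {x : ℝ} (hx : x ∈ Ioo (-1 : ℝ) 1) : 0 < 1 - x ^ 2 := by
  nlinarith [hx.1, hx.2]

section

variable {f : ℝ → ℝ}

theorem integrableOn_sq_mul_sqrt (hf : MemLp (fun x : ℝ => f x * (1 - x ^ 2) ^ (1 / 4 : ℝ)) 2
      (volume.restrict (Ioo (-1 : ℝ) 1))) :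
    IntegrableOn (fun x => f x ^ 2 * √(1 - x ^ 2)) (Ioo (-1 : ℝ) 1) := by
  refine (integrableOn_congr_fun (fun x hx => ?_) measurableSet_Ioo).1
    ((memLp_two_iff_integrable_sq hf.1).1 hf)
  simp only [mul_pow, rpow_quarter_sq (one_sub_sq_pos_of_mem hx).le]

/-- By the Cauchy–Schwarz inequality, since the arcsine density is integrable. -/
theorem integrableOn_of_memLp (hf : MemLp (fun x : ℝ => f x * (1 - x ^ 2) ^ (1 / 4 : ℝ)) 2
      (volume.restrict (Ioo (-1 : ℝ) 1))) : IntegrableOn f (Ioo (-1 : ℝ) 1) := by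
  have hw : MemLp (fun x : ℝ => ((1 - x ^ 2) ^ (1 / 4 : ℝ))⁻¹) 2
      (volume.restrict (Ioo (-1 : ℝ) 1)) := by
    refine (memLp_two_iff_integrable_sq (Measurable.aestronglyMeasurable (by fun_prop))).2 ?_
    refine (integrableOn_congr_fun (fun x hx => ?_) measurableSet_Ioo).1
      integrableOn_arcsine_density
    simp only [inv_pow, rpow_quarter_sq (one_sub_sq_pos_of_mem hx).le]
  refine (integrableOn_congr_fun (fun x hx => ?_) measurableSet_Ioo).1 (hf.integrable_mul hw)
  have := Real.rpow_pos_of_pos (one_sub_sq_pos_of_mem hx) (1 / 4)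
  simp only [Pi.mul_apply]
  field_simp

theorem setIntegral_eq_zero_of_arcsine_mean
    (hmean : ∫ x, f x * √(1 - x ^ 2) ∂arcsineMeasure = 0) :
    ∫ x in Ioo (-1 : ℝ) 1, f x = 0 := by
  rw [arcsineMeasure, integral_withDensity_eq_integral_toReal_smul (by fun_prop)
    (ae_of_all _ fun x => ENNReal.ofReal_lt_top)] at hmean
  have h : ∫ x in Ioo (-1 : ℝ) 1, (ENNReal.ofReal (1 / (Real.pi * √(1 - x ^ 2)))).toReal •
      (f x * √(1 - x ^ 2)) = ∫ x in Ioo (-1 : ℝ) 1, Real.pi⁻¹ * f x := by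
    refine setIntegral_congr_fun measurableSet_Ioo fun x hx => ?_
    have hs := Real.sqrt_pos.2 (one_sub_sq_pos_of_mem hx)
    have hπ := Real.pi_pos
    simp only [ENNReal.toReal_ofReal (by positivity : 0 ≤ 1 / (Real.pi * √(1 - x ^ 2))),
      smul_eq_mul]
    field_simp
  rw [h, integral_const_mul] at hmean
  exact (mul_eq_zero.1 hmean).resolve_left (inv_ne_zero Real.pi_ne_zero)

/-- The function `φ ↦ f (cos φ) |sin φ|`, the even periodic function on the circle whose conjugate
function describes the finite Hilbert transform of `f`. -/
noncomputable def angularLift (f : ℝ → ℝ) (φ : ℝ) : ℝ := f (Real.cos φ) * |Real.sin φ|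

theorem angularLift_of_mem {θ : ℝ} (hθ : θ ∈ Ioo 0 Real.pi) :
    angularLift f θ = Real.sin θ * f (Real.cos θ) := by
  rw [angularLift, abs_of_pos (Real.sin_pos_of_mem_Ioo hθ), mul_comm]

theorem angularLift_neg (f : ℝ → ℝ) (φ : ℝ) : angularLift f (-φ) = angularLift f φ := by
  simp [angularLift]

theorem angularLift_periodic (f : ℝ → ℝ) : Function.Periodic (angularLift f) (2 * Real.pi) := by
  intro φ
  simp [angularLift]

theorem integrableOn_angularLift (hf : IntegrableOn f (Ioo (-1 : ℝ) 1)) :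
    IntegrableOn (angularLift f) (Ioc (-Real.pi) Real.pi) := by
  refine integrableOn_Ioc_of_even Real.pi_pos ?_ (angularLift_neg f)
  refine (integrableOn_congr_fun (fun θ hθ => ?_) measurableSet_Ioo).2
    ((integrableOn_cos_substitution f).1 hf)
  rw [angularLift_of_mem hθ, smul_eq_mul]

theorem setIntegral_sq_mul_sqrt (f : ℝ → ℝ) :
    ∫ x in Ioo (-1 : ℝ) 1, f x ^ 2 * √(1 - x ^ 2) =
      ∫ θ in Ioo 0 Real.pi, angularLift f θ ^ 2 := by
  rw [setIntegral_cos_substitution]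
  refine setIntegral_congr_fun measurableSet_Ioo fun θ hθ => ?_
  simp only [angularLift_of_mem hθ, sqrt_one_sub_cos_sq hθ, smul_eq_mul]
  ring

theorem memLp_angularLift (hf : IntegrableOn f (Ioo (-1 : ℝ) 1))
    (hf2 : IntegrableOn (fun x => f x ^ 2 * √(1 - x ^ 2)) (Ioo (-1 : ℝ) 1)) :
    MemLp (angularLift f) 2 (volume.restrict (Ioc (-Real.pi) Real.pi)) := by
  refine (memLp_two_iff_integrable_sq (integrableOn_angularLift hf).1).2 ?_
  refine integrableOn_Ioc_of_even (F := fun φ => angularLift f φ ^ 2) Real.pi_pos ?_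
    (fun φ => by rw [angularLift_neg])
  refine (integrableOn_congr_fun (fun θ hθ => ?_) measurableSet_Ioo).2
    ((integrableOn_cos_substitution _).1 hf2)
  simp only [angularLift_of_mem hθ, sqrt_one_sub_cos_sq hθ, smul_eq_mul]
  ring

theorem setIntegral_angularLift (hf : IntegrableOn f (Ioo (-1 : ℝ) 1))
    (h0 : ∫ x in Ioo (-1 : ℝ) 1, f x = 0) :
    ∫ φ in Ioc (-Real.pi) Real.pi, angularLift f φ = 0 := by
  rw [setIntegral_Ioc_eq_of_ae_even Real.pi_pos (integrableOn_angularLift hf)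
    (ae_of_all _ (angularLift_neg f))]
  rw [setIntegral_cos_substitution] at h0
  rw [setIntegral_congr_fun (g := fun θ => Real.sin θ • f (Real.cos θ)) measurableSet_Ioo
    fun θ hθ => angularLift_of_mem hθ, h0, smul_zero]

end

/-! ### The principal value -/

/-- The boundary value of the Cauchy transform at `cos θ`, once known in angular coordinates,
determines the limit of the truncations. -/
theorem tendsto_truncatedHilbert_of_boundary {f : ℝ → ℝ}
    (hf : IntegrableOn f (Ioo (-1 : ℝ) 1)) {x η : ℝ}
    (hx : x ∈ Ioo (-1 : ℝ) 1) (hL : IsLebesguePoint (extendZero f) x)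
    (hb : Tendsto (fun δ : ℝ => ∫ φ in Ioo 0 Real.pi,
        Complex.sinh (δ - Real.arccos x * Complex.I) /
          (Complex.cosh (δ - Real.arccos x * Complex.I) - Complex.cos φ) * angularLift f φ)
        (𝓝[>] 0) (𝓝 (Real.pi * (angularLift f (Real.arccos x) + η * Complex.I)))) :
    Tendsto (fun ε => truncatedHilbert ε (extendZero f) x) (𝓝[>] 0)
      (𝓝 (-η / √(1 - x ^ 2))) := by
  set s := √(1 - x ^ 2) with hs
  have hs0 : 0 < s := Real.sqrt_pos.2 (one_sub_sq_pos_of_mem hx)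
  set θ := Real.arccos x with hθ
  have hcos : Real.cos θ = x := Real.cos_arccos hx.1.le hx.2.le
  have hsin : Real.sin θ = s := Real.sin_arccos x
  have hu : Integrable (extendZero f) := hf.integrable_indicator measurableSet_Ioo
  -- `ε = s * sinh δ` is the height of the point `cosh (δ - iθ)` below the real axis.
  set d : ℝ → ℝ := fun ε => Real.arsinh (ε / s) with hd
  have hd0 : Tendsto d (𝓝[>] 0) (𝓝[>] 0) := by
    refine tendsto_nhdsWithin_of_tendsto_nhds_of_eventually_within _ ?_ ?_
    · have h : Continuous d := Real.continuous_arsinh.comp (continuous_id.div_const s)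
      have := h.tendsto 0
      simp only [hd, zero_div, Real.arsinh_zero] at this
      exact this.mono_left nhdsWithin_le_nhds
    · filter_upwards [self_mem_nhdsWithin] with ε hε
      exact Real.arsinh_pos_iff.2 (div_pos hε hs0)
  set a : ℝ → ℝ := fun ε => x * Real.cosh (d ε) with ha
  have hsinh : ∀ ε, Real.sinh (d ε) = ε / s := fun ε => Real.sinh_arsinh _
  have ha1 : ∀ ε, |a ε - x| ≤ (s ^ 2)⁻¹ * ε ^ 2 := by
    intro ε
    have h1 : a ε - x = x * (Real.cosh (d ε) - 1) := by simp only [ha]; ring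
    have h2 := Real.one_le_cosh (d ε)
    have h3 : Real.cosh (d ε) - 1 ≤ Real.sinh (d ε) ^ 2 := by
      nlinarith [Real.cosh_sq (d ε)]
    have h4 : |x| ≤ 1 := abs_le.2 ⟨hx.1.le, hx.2.le⟩
    rw [h1, abs_mul, abs_of_nonneg (sub_nonneg.2 h2)]
    calc |x| * (Real.cosh (d ε) - 1) ≤ 1 * (Real.cosh (d ε) - 1) :=
          mul_le_mul_of_nonneg_right h4 (sub_nonneg.2 h2)
      _ ≤ Real.sinh (d ε) ^ 2 := by rwa [one_mul]
      _ = (s ^ 2)⁻¹ * ε ^ 2 := by rw [hsinh, div_pow]; ring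
  have hcosh : ∀ ε : ℝ, Complex.cosh (d ε - θ * Complex.I) = a ε - ε * Complex.I := by
    intro ε
    rw [Complex.cosh_sub, Complex.cosh_mul_I, Complex.sinh_mul_I, ← Complex.ofReal_cosh,
      ← Complex.ofReal_sinh, ← Complex.ofReal_cos, ← Complex.ofReal_sin, hcos, hsin, hsinh]
    have : (s : ℂ) ≠ 0 := by exact_mod_cast hs0.ne'
    simp only [ha]
    push_cast
    field_simp
  have hsinhlim : Tendsto (fun ε : ℝ => Complex.sinh (d ε - θ * Complex.I)) (𝓝[>] 0)
      (𝓝 (-(s * Complex.I))) := by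
    have h1 : Continuous fun δ : ℝ => Complex.sinh (δ - θ * Complex.I) := by fun_prop
    have h2 := (h1.tendsto 0).mono_left (nhdsWithin_le_nhds (s := Ioi 0))
    have h3 : Complex.sinh ((0 : ℝ) - θ * Complex.I) = -(s * Complex.I) := by
      rw [Complex.ofReal_zero, zero_sub, Complex.sinh_neg, Complex.sinh_mul_I,
        ← Complex.ofReal_sin, hsin]
    rw [h3] at h2
    exact h2.comp hd0
  have hsI : -((s : ℂ) * Complex.I) ≠ 0 :=
    neg_ne_zero.2 (mul_ne_zero (by exact_mod_cast hs0.ne') Complex.I_ne_zero)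
  have hquot := (hb.comp hd0).div hsinhlim hsI
  have hre := (Complex.continuous_re.tendsto _).comp hquot
  have hval : (Real.pi * (angularLift f θ + η * Complex.I) / -(s * Complex.I) : ℂ).re =
      -(Real.pi * η) / s := by
    have h1 : (Real.pi * (angularLift f θ + η * Complex.I) / -(s * Complex.I) : ℂ) =
        ((-(Real.pi * η) / s : ℝ) : ℂ) + ((Real.pi * angularLift f θ / s : ℝ) : ℂ) * Complex.I := by
      have : (s : ℂ) ≠ 0 := by exact_mod_cast hs0.ne'
      rw [div_eq_iff hsI]
      push_cast
      field_simp
      linear_combination (angularLift f θ : ℂ) * Complex.I_sq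
    rw [h1]
    simp
  have hcauchy : Tendsto (fun ε : ℝ =>
      ∫ y : ℝ, ((a ε - ε * Complex.I - y : ℂ)⁻¹).re * extendZero f y) (𝓝[>] 0)
      (𝓝 (-(Real.pi * η) / s)) := by
    rw [hval] at hre
    refine hre.congr' ?_
    have hne : ∀ᶠ ε in 𝓝[>] (0 : ℝ), Complex.sinh (d ε - θ * Complex.I) ≠ 0 :=
      hsinhlim.eventually_ne hsI
    filter_upwards [self_mem_nhdsWithin, hne] with ε hε hε2
    have hε : 0 < ε := hε
    have hsub : (∫ φ in Ioo 0 Real.pi, Complex.sinh (d ε - θ * Complex.I) /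
          (Complex.cosh (d ε - θ * Complex.I) - Complex.cos φ) * angularLift f φ) =
        Complex.sinh (d ε - θ * Complex.I) *
          ∫ y in Ioo (-1 : ℝ) 1, (a ε - ε * Complex.I - y : ℂ)⁻¹ * f y := by
      rw [setIntegral_cos_substitution, ← integral_const_mul]
      refine setIntegral_congr_fun measurableSet_Ioo fun φ hφ => ?_
      simp only [angularLift_of_mem hφ, hcosh, Complex.real_smul]
      push_cast
      ring
    simp only [Function.comp]
    have hint : Integrable fun y : ℝ => (a ε - ε * Complex.I - y : ℂ)⁻¹ * extendZero f y := by
      refine hu.ofReal.bdd_mul (c := ε⁻¹) (Measurable.aestronglyMeasurable (by fun_prop))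
        (ae_of_all _ fun y => ?_)
      rw [norm_inv]
      refine inv_anti₀ hε ?_
      simpa [abs_of_pos hε] using Complex.abs_im_le_norm (a ε - ε * Complex.I - y : ℂ)
    have hext : ∫ y in Ioo (-1 : ℝ) 1, (a ε - ε * Complex.I - y : ℂ)⁻¹ * f y =
        ∫ y : ℝ, (a ε - ε * Complex.I - y : ℂ)⁻¹ * extendZero f y := by
      rw [← integral_indicator measurableSet_Ioo]
      refine integral_congr_ae (ae_of_all _ fun y => ?_)
      by_cases hy : y ∈ Ioo (-1 : ℝ) 1
      · simp only [extendZero, indicator_of_mem hy]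
      · simp only [extendZero, indicator_of_notMem hy, Complex.ofReal_zero, mul_zero]
    rw [Pi.div_apply, Function.comp, hsub, mul_div_cancel_left₀ _ hε2, hext]
    refine (integral_re hint).symm.trans ?_
    refine integral_congr_ae (ae_of_all _ fun y => ?_)
    exact Complex.re_mul_ofReal _ _
  have hsupp : ∀ y ∉ Metric.closedBall x 2, extendZero f y = 0 := by
    intro y hy
    refine indicator_of_notMem (fun hy2 => hy ?_) _
    rw [Metric.mem_closedBall, Real.dist_eq, abs_le]
    constructor <;> linarith [hy2.1, hy2.2, hx.1, hx.2]
  have hsum := (((tendsto_truncated_sub_re_cauchy two_pos hu hsupp hL).add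
    (tendsto_re_cauchy_sub_re_cauchy hu ha1)).add hcauchy).const_mul (1 / Real.pi)
  have hlim : 1 / Real.pi * (0 + 0 + -(Real.pi * η) / s) = -η / s := by
    have := Real.pi_ne_zero
    field_simp
    ring
  rw [hlim] at hsum
  refine hsum.congr fun ε => ?_
  rw [truncatedHilbert]
  ring

theorem theorem2 (f : ℝ → ℝ)
    (hf : MemLp (fun x : ℝ => f x * (1 - x ^ 2) ^ (1 / 4 : ℝ)) 2
      (volume.restrict (Ioo (-1 : ℝ) 1)))
    (hmean : ∫ x, f x * Real.sqrt (1 - x ^ 2) ∂arcsineMeasure = 0) :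
    (∀ᵐ x ∂(volume.restrict (Ioo (-1 : ℝ) 1)),
      Tendsto (fun ε => truncatedHilbert ε (extendZero f) x) (𝓝[>] (0 : ℝ))
        (𝓝 (finiteHilbert f x))) ∧
    IntegrableOn (fun x => finiteHilbert f x ^ 2 * Real.sqrt (1 - x ^ 2)) (Ioo (-1 : ℝ) 1) ∧
    IntegrableOn (fun x => f x ^ 2 * Real.sqrt (1 - x ^ 2)) (Ioo (-1 : ℝ) 1) ∧
    ∫ x in Ioo (-1 : ℝ) 1, finiteHilbert f x ^ 2 * Real.sqrt (1 - x ^ 2) =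
      ∫ x in Ioo (-1 : ℝ) 1, f x ^ 2 * Real.sqrt (1 - x ^ 2) := by
  have hf1 := integrableOn_of_memLp hf
  have hf2 := integrableOn_sq_mul_sqrt hf
  have h0 := setIntegral_eq_zero_of_arcsine_mean hmean
  obtain ⟨η, hηi, hηeq, hη⟩ := exists_conjugate_boundary (angularLift_periodic f)
    (angularLift_neg f) (memLp_angularLift hf1 hf2) (setIntegral_angularLift hf1 h0)
  have hu : Integrable (extendZero f) := hf1.integrable_indicator measurableSet_Ioo
  have hlim : ∀ᵐ x ∂(volume.restrict (Ioo (-1 : ℝ) 1)),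
      Tendsto (fun ε => truncatedHilbert ε (extendZero f) x) (𝓝[>] (0 : ℝ))
        (𝓝 (-η (Real.arccos x) / √(1 - x ^ 2))) := by
    rw [ae_restrict_iff' measurableSet_Ioo]
    filter_upwards [ae_arccos hη, ae_isLebesguePoint hu.locallyIntegrable] with x h1 h2 hx
    exact tendsto_truncatedHilbert_of_boundary hf1 hx h2 (h1 hx)
  have hval : ∀ᵐ x ∂(volume.restrict (Ioo (-1 : ℝ) 1)),
      finiteHilbert f x = -η (Real.arccos x) / √(1 - x ^ 2) :=
    hlim.mono fun x hx => hx.limUnder_eq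
  have hsq : (fun x => (-η (Real.arccos x) / √(1 - x ^ 2)) ^ 2 * √(1 - x ^ 2)) =ᵐ[
      volume.restrict (Ioo (-1 : ℝ) 1)] fun x => finiteHilbert f x ^ 2 * √(1 - x ^ 2) := by
    filter_upwards [hval] with x hx
    rw [hx]
  have hcos : ∀ θ ∈ Ioo 0 Real.pi, Real.sin θ • ((-η (Real.arccos (Real.cos θ)) /
      √(1 - Real.cos θ ^ 2)) ^ 2 * √(1 - Real.cos θ ^ 2)) = η θ ^ 2 := by
    intro θ hθ
    have := Real.sin_pos_of_mem_Ioo hθ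
    rw [sqrt_one_sub_cos_sq hθ, Real.arccos_cos hθ.1.le hθ.2.le, smul_eq_mul]
    field_simp
  refine ⟨?_, ?_, hf2, ?_⟩
  · filter_upwards [hlim, hval] with x h1 h2
    rwa [h2]
  · refine Integrable.congr ?_ hsq
    exact (integrableOn_cos_substitution _).2
      ((integrableOn_congr_fun hcos measurableSet_Ioo).2 hηi)
  · rw [← integral_congr_ae hsq, setIntegral_cos_substitution, setIntegral_sq_mul_sqrt,
      setIntegral_congr_fun measurableSet_Ioo hcos, hηeq]
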